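/- Consider a hidden Markov model with two hidden states: $\mathbf X=(X_1,X_2,\dots)$ is a Markov chain on $\mathbb X=\{1,2\}$ with initial distribution $\nu$ and transition matrix $Q$, and, conditionally on $\mathbf X$, the observations $Y_1,Y_2,\dots$ are independent, take values in a Polish space $\mathbb Y$ with its Borel $\sigma$-field, and $Y_i$ has probability density $f_{X_i}$ with respect to a dominating measure $\mathcal L$ on $\mathbb Y$. Write $\theta=(\nu,Q,(f_x)_{x\in\mathbb X})$ for the parameter. For $n\ge 1$ let $\Pi_n$ be the random partition of $[n]=\{1,\dots,n\}$ given by $i\sim j\iff X_i=X_j$. For partitions $A,B$ of $[n]$ put $\ell(A,B)=1-\frac1n\sup_M\sum_{\{C,C'\}\in M}\mathrm{Card}(C\cap C')$, the supremum being over all matchings $M$ of the complete bipartite graph between the blocks $C$ of $A$ and the blocks $C'$ of $B$. Let $\mathcal G_n$ be the set of measurable maps $g$ from $\mathbb Y^n$ to the set of partitions of $[n]$ and $\mathcal H_n$ the set of measurable maps $h:\mathbb Y^n\to\mathbb X^n$, and define $$\mathcal R_n^{\mathrm{clust}}(\theta,g)=\mathbb E_\theta\big[\ell(g(Y_{1:n}),\Pi_n)\big],\qquad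 \mathcal R_n^{\mathrm{class}}(\theta,h)=\mathbb E_\theta\Big[\frac1n\sum_{i=1}^n\mathbf 1_{h_i(Y_{1:n})\ne X_i}\Big].$$ Suppose that the two rows of $Q$ are different, that $\delta=\min_{x,x'}Q_{x,x'}>0$, and that $\min_x\nu_x\ge\delta$. Then for all $n\ge 1$ $$(1-\tilde\alpha_n)\inf_{h\in\mathcal H_n}\mathcal R_n^{\mathrm{class}}(\theta,h)\ \le\ \inf_{g\in\mathcal G_n}\mathcal R_n^{\mathrm{clust}}(\theta,g)\ \le\ \inf_{h\in\mathcal H_n}\mathcal R_n^{\mathrm{class}}(\theta,h),$$ where $$\tilde\alpha_n=2e\Big(\frac{1-\delta}{\delta}\Big)^4\Big[\frac{1-\delta}{\delta}\sqrt{\frac{\log 2}{2n}}\,\Big]^{1-2/n}.$$ -/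

import Mathlib

open MeasureTheory
open scoped ENNReal

noncomputable section

namespace HMMClustering

/-- A valid parameter `θ = (ν, Q, (f x))` of a hidden Markov model with `J` hidden states and
observations in `𝕐`: initial distribution `ν`, transition matrix `Q`, and emission
probability densities `f x` with respect to the dominating measure `L`. -/
structure Param (J : ℕ) (𝕐 : Type*) [MeasurableSpace 𝕐] (L : Measure 𝕐) where
  ν : Fin J → ℝ
  ν_nonneg : ∀ x, 0 ≤ ν x
  ν_sum : ∑ x, ν x = 1
  Q : Matrix (Fin J) (Fin J) ℝ
  Q_nonneg : ∀ x x', 0 ≤ Q x x'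
  Q_sum : ∀ x, ∑ x', Q x x' = 1
  f : Fin J → 𝕐 → ℝ≥0∞
  f_measurable : ∀ x, Measurable (f x)
  f_lintegral : ∀ x, ∫⁻ y, f x y ∂L = 1

variable {J : ℕ} {𝕐 : Type*} [MeasurableSpace 𝕐] {L : Measure 𝕐}

/-- The emission distribution `f x dL` of the hidden state `x`. -/
def Param.emission (θ : Param J 𝕐 L) (x : Fin J) : Measure 𝕐 := L.withDensity (θ.f x)

instance (θ : Param J 𝕐 L) (x : Fin J) : IsProbabilityMeasure (θ.emission x) :=
  ⟨by rw [Param.emission, withDensity_apply _ MeasurableSet.univ, setLIntegral_univ, θ.f_lintegral]⟩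

/-- The dependent case: the rows of `Q` are not all equal. -/
def Param.IsDependent (θ : Param J 𝕐 L) : Prop := ∃ x x', θ.Q x ≠ θ.Q x'

/-- The mixing assumption: `δ = min_{x,x'} Q x x' > 0` and `min_x ν x ≥ δ`. -/
def Param.IsMixing (θ : Param J 𝕐 L) (δ : ℝ) : Prop :=
  IsLeast (Set.range fun p : Fin J × Fin J => θ.Q p.1 p.2) δ ∧ 0 < δ ∧ ∀ x, δ ≤ θ.ν x

/-- `P_θ(X_{1:n} = x) = ν(x₁) Q(x₁, x₂) ⋯ Q(x_{n-1}, x_n)`. -/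
def Param.pathProb (θ : Param J 𝕐 L) : {n : ℕ} → (Fin n → Fin J) → ℝ
  | 0, _ => 1
  | _ + 1, x => θ.ν (x 0) * ∏ i, θ.Q (x (Fin.castSucc i)) (x (Fin.succ i))

/-- The joint law under `P_θ` of `(X_{1:n}, Y_{1:n})`: the hidden states form a Markov chain with
initial law `ν` and transition matrix `Q`, and given the hidden states the observations are
independent, `Y_i` having the emission distribution of `X_i`. -/
def Param.law (θ : Param J 𝕐 L) (n : ℕ) : Measure ((Fin n → Fin J) × (Fin n → 𝕐)) :=
  ∑ x : Fin n → Fin J, ENNReal.ofReal (θ.pathProb x) •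
    (Measure.dirac x).prod (Measure.pi fun i => θ.emission (x i))

/-- Partitions of `[n]`. -/
abbrev Partition (n : ℕ) : Type := Finpartition (Finset.univ : Finset (Fin n))

/-- The finite set of partitions of `[n]` carries the discrete σ-algebra. -/
instance (n : ℕ) : MeasurableSpace (Partition n) := ⊤

/-- The partition of `[n]` induced by a labelling: `i ∼ j` iff `x i = x j`. -/
def labelPartition {n : ℕ} (x : Fin n → Fin J) : Partition n :=
  open Classical in Finpartition.ofSetoid (Setoid.ker x)

/-- Matchings of the complete bipartite graph on the blocks of `A` and the blocks of `B`:
sets of edges, no two of which share a vertex. -/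
def IsMatching {n : ℕ} (A B : Partition n) (M : Finset (Finset (Fin n) × Finset (Fin n))) : Prop :=
  M ⊆ A.parts ×ˢ B.parts ∧ ∀ e ∈ M, ∀ e' ∈ M, (e.1 = e'.1 ∨ e.2 = e'.2) → e = e'

/-- The largest total overlap `∑ Card (C ∩ C')` of a matching. -/
def maxOverlap {n : ℕ} (A B : Partition n) : ℕ :=
  open Classical in
  (Finset.univ.filter (IsMatching A B)).sup fun M => ∑ e ∈ M, (e.1 ∩ e.2).card

/-- The misclassification error distance between two partitions. -/
def loss {n : ℕ} (A B : Partition n) : ℝ := 1 - (1 / (n : ℝ)) * (maxOverlap A B : ℝ)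

/-- The `n`-clusterers. -/
abbrev Clusterer (𝕐 : Type*) [MeasurableSpace 𝕐] (n : ℕ) : Type _ :=
  {g : (Fin n → 𝕐) → Partition n // Measurable g}

/-- The `n`-classifiers. -/
abbrev Classifier (J : ℕ) (𝕐 : Type*) [MeasurableSpace 𝕐] (n : ℕ) : Type _ :=
  {h : (Fin n → 𝕐) → (Fin n → Fin J) // Measurable h}

/-- The risk of clustering `E_θ[ℓ(g(Y_{1:n}), Π_n)]`. -/
def Param.clustRisk (θ : Param J 𝕐 L) {n : ℕ} (g : Clusterer 𝕐 n) : ℝ :=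
  ∫ p, loss (g.1 p.2) (labelPartition p.1) ∂(θ.law n)

/-- The risk of classification `E_θ[(1/n) ∑ᵢ 1{hᵢ(Y_{1:n}) ≠ Xᵢ}]`. -/
def Param.classRisk (θ : Param J 𝕐 L) {n : ℕ} (h : Classifier J 𝕐 n) : ℝ :=
  ∫ p, (1 / (n : ℝ)) * ∑ i, (if h.1 p.2 i ≠ p.1 i then (1 : ℝ) else 0) ∂(θ.law n)

/-- The Bayes risk of clustering. -/
def Param.bayesClustRisk (θ : Param J 𝕐 L) (n : ℕ) : ℝ := ⨅ g : Clusterer 𝕐 n, θ.clustRisk g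

/-- The Bayes risk of classification. -/
def Param.bayesClassRisk (θ : Param J 𝕐 L) (n : ℕ) : ℝ := ⨅ h : Classifier J 𝕐 n, θ.classRisk h

/-- `α̃_n = 2e ((1-δ)/δ)⁴ [((1-δ)/δ) √(log 2 / (2n))]^{1 - 2/n}`. -/
def alphaTilde (δ : ℝ) (n : ℕ) : ℝ :=
  2 * Real.exp 1 * ((1 - δ) / δ) ^ 4 *
    ((1 - δ) / δ * Real.sqrt (Real.log 2 / (2 * (n : ℝ)))) ^ (1 - 2 / (n : ℝ))

end HMMClustering

end

/-! The upper bound holds because the partition induced by a classifier loses at most its fraction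
of mislabelled points: pair the blocks carrying the same label (`loss_labelPartition_le`).

The lower bound is proved pointwise in the observations. Given `y`, the posterior of the hidden path
is an inhomogeneous Markov chain (`exists_isMixingKernel`) whose kernels forget the previous state
at a rate depending only on `r = (1 - δ) / δ`, whatever the emission densities are.

A clustering `A` is reduced to two-block labellings by drawing a point `i` uniformly and separating
its block from the rest. On average over `i`, the error of this labelling, up to exchanging the two
labels, is at most the loss of `A`. This is a deterministic quadratic inequality
(`card_mul_maxOverlap_le`).

For one two-block labelling let `m` be the number of mismatches. Then `min m (n - m) = m - max (2 m
- n) 0`, and after exchanging labels `E m ≤ n / 2`. The excess `T = E max (2 m - n) 0` is negligible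
compared with `E m` (`excess_le`), because two bounds can be interpolated: `T / n ≤ s = r √(log 2 /
(2 n))` from the variance, and `T / n ≤ (2 e r² E m / n) ^ (n / 2)` from a Chernoff bound. Writing
`T / n` as the product of its powers `1 - 2 / n` and `2 / n` makes the second factor linear in `E
m`, which gives a multiplicative error.

Finally, the expected mismatches of any labelling dominate those of the posterior marginal
classifier, and integrating over `y` compares the two risks. -/

noncomputable section

namespace HMMClustering

/-! ### Path sums of two-state chains -/

/-- The sum of `F` over the paths of length `n` of an inhomogeneous chain on two states which is
started from `x` and has the (unnormalized) transition weights `φ 0, φ 1, …`. -/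
def chainSum : (n : ℕ) → (ℕ → Fin 2 → Fin 2 → ℝ) → Fin 2 → ((Fin n → Fin 2) → ℝ) → ℝ
  | 0, _, _, F => F Fin.elim0
  | n + 1, φ, x, F =>
    ∑ z, φ 0 x z * chainSum n (fun k => φ (k + 1)) z (fun v => F (Fin.cons z v))

theorem chainSum_eq_sum (n : ℕ) (φ : ℕ → Fin 2 → Fin 2 → ℝ) (x : Fin 2)
    (F : (Fin n → Fin 2) → ℝ) :
    chainSum n φ x F =
      ∑ v, (∏ i : Fin n, φ i ((Fin.cons x v : Fin (n + 1) → Fin 2) i.castSucc) (v i)) * F v := by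
  induction n generalizing φ x with
  | zero =>
    simp only [chainSum, Finset.univ_unique, Finset.sum_singleton, Finset.univ_eq_empty,
      Finset.prod_empty, one_mul]
    exact congrArg F (Subsingleton.elim _ _)
  | succ n ih =>
    rw [chainSum, ← (Fin.consEquiv fun _ => Fin 2).sum_comp, Fintype.sum_prod_type]
    refine Finset.sum_congr rfl fun z _ => ?_
    rw [ih, Finset.mul_sum]
    refine Finset.sum_congr rfl fun v _ => ?_
    rw [← mul_assoc]
    congr 1
    simp only [Fin.consEquiv_apply]
    rw [Fin.prod_univ_succ]
    simp

theorem chainSum_add (n : ℕ) (φ : ℕ → Fin 2 → Fin 2 → ℝ) (x : Fin 2)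
    (F G : (Fin n → Fin 2) → ℝ) :
    chainSum n φ x (fun v => F v + G v) = chainSum n φ x F + chainSum n φ x G := by
  simp only [chainSum_eq_sum, mul_add, Finset.sum_add_distrib]

theorem chainSum_mul_left (n : ℕ) (φ : ℕ → Fin 2 → Fin 2 → ℝ) (x : Fin 2) (c : ℝ)
    (F : (Fin n → Fin 2) → ℝ) :
    chainSum n φ x (fun v => c * F v) = c * chainSum n φ x F := by
  simp only [chainSum_eq_sum, Finset.mul_sum]
  exact Finset.sum_congr rfl fun v _ => by ring

theorem chainSum_sub (n : ℕ) (φ : ℕ → Fin 2 → Fin 2 → ℝ) (x : Fin 2)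
    (F G : (Fin n → Fin 2) → ℝ) :
    chainSum n φ x (fun v => F v - G v) = chainSum n φ x F - chainSum n φ x G := by
  simp only [chainSum_eq_sum, mul_sub, Finset.sum_sub_distrib]

theorem chainSum_mono {n : ℕ} {φ : ℕ → Fin 2 → Fin 2 → ℝ} (hφ : ∀ i x z, 0 ≤ φ i x z) (x : Fin 2)
    {F G : (Fin n → Fin 2) → ℝ} (h : ∀ v, F v ≤ G v) :
    chainSum n φ x F ≤ chainSum n φ x G := by
  simp only [chainSum_eq_sum]
  exact Finset.sum_le_sum fun v _ =>
    mul_le_mul_of_nonneg_left (h v) (Finset.prod_nonneg fun i _ => hφ _ _ _)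

theorem chainSum_nonneg {n : ℕ} {φ : ℕ → Fin 2 → Fin 2 → ℝ} (hφ : ∀ i x z, 0 ≤ φ i x z)
    (x : Fin 2) {F : (Fin n → Fin 2) → ℝ} (h : ∀ v, 0 ≤ F v) : 0 ≤ chainSum n φ x F := by
  rw [chainSum_eq_sum]
  exact Finset.sum_nonneg fun v _ => mul_nonneg (Finset.prod_nonneg fun i _ => hφ _ _ _) (h v)

/-! ### Mixing kernels and the posterior chain -/

/-- A sequence of transition kernels on two states whose rows are comparable up to the factor
`r ^ 2` and at distance at most `1 - 1 / r` from each other. -/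
structure IsMixingKernel (r : ℝ) (K : ℕ → Fin 2 → Fin 2 → ℝ) : Prop where
  nonneg : ∀ i x z, 0 ≤ K i x z
  sum_eq_one : ∀ i x, ∑ z, K i x z = 1
  le_mul : ∀ i x x' z, K i x z ≤ r ^ 2 * K i x' z
  abs_sub_le : ∀ i x x' z, |K i x z - K i x' z| ≤ 1 - 1 / r

theorem IsMixingKernel.shift {r : ℝ} {K : ℕ → Fin 2 → Fin 2 → ℝ} (hK : IsMixingKernel r K) :
    IsMixingKernel r fun k => K (k + 1) :=
  ⟨fun _ => hK.nonneg _, fun _ => hK.sum_eq_one _, fun _ => hK.le_mul _,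
    fun _ => hK.abs_sub_le _⟩

theorem IsMixingKernel.cons {r : ℝ} {K : ℕ → Fin 2 → Fin 2 → ℝ} (hK : IsMixingKernel r K)
    {k : Fin 2 → Fin 2 → ℝ} (h0 : ∀ x z, 0 ≤ k x z) (h1 : ∀ x, ∑ z, k x z = 1)
    (h2 : ∀ x x' z, k x z ≤ r ^ 2 * k x' z) (h3 : ∀ x x' z, |k x z - k x' z| ≤ 1 - 1 / r) :
    IsMixingKernel r fun i => Nat.casesOn i k K := by
  constructor <;> rintro (_ | i)
  exacts [h0, hK.nonneg i, h1, hK.sum_eq_one i, h2, hK.le_mul i, h3, hK.abs_sub_le i]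

/-- A filler kernel, for the empty chain and for posteriors of total mass zero, where any kernel
will do. -/
theorem isMixingKernel_uniform {r : ℝ} (hr : 1 ≤ r) :
    IsMixingKernel r fun _ _ _ => (1 / 2 : ℝ) := by
  refine ⟨fun _ _ _ => by norm_num, fun _ _ => by norm_num, fun _ _ _ _ => by nlinarith,
    fun _ _ _ _ => ?_⟩
  have : 1 / r ≤ 1 := by rw [div_le_one (by linarith)]; exact hr
  simpa using this

theorem IsMixingKernel.chainSum_const {r : ℝ} {K : ℕ → Fin 2 → Fin 2 → ℝ}
    (hK : IsMixingKernel r K) (n : ℕ) (x : Fin 2) (c : ℝ) : chainSum n K x (fun _ => c) = c := by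
  induction n generalizing K x with
  | zero => rfl
  | succ n ih =>
    simp only [chainSum, ih hK.shift]
    rw [← Finset.sum_mul, hK.sum_eq_one, one_mul]

/-- Tilting a strictly positive transition matrix by a nonnegative function of the new state gives
kernels which mix at least as well, uniformly in the tilting. -/
theorem tilted_kernel_mixing {δ : ℝ} (hδ : 0 < δ) {q : Fin 2 → Fin 2 → ℝ}
    (hq : ∀ x z, δ ≤ q x z) (hq' : ∀ x z, q x z ≤ 1 - δ) {c : Fin 2 → ℝ} (hc : ∀ z, 0 ≤ c z)
    (hpos : 0 < ∑ z, c z) :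
    (∀ x, 0 < ∑ z, q x z * c z) ∧
    (∀ x x' z, q x z * c z / ∑ w, q x w * c w ≤
      ((1 - δ) / δ) ^ 2 * (q x' z * c z / ∑ w, q x' w * c w)) ∧
    (∀ x x' z, |q x z * c z / (∑ w, q x w * c w) - q x' z * c z / ∑ w, q x' w * c w| ≤
      1 - 1 / ((1 - δ) / δ)) := by
  have hδ1 : 0 < 1 - δ := lt_of_lt_of_le hδ ((hq 0 0).trans (hq' 0 0))
  have hβl : ∀ x, δ * ∑ z, c z ≤ ∑ z, q x z * c z := fun x => by
    rw [Finset.mul_sum]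
    exact Finset.sum_le_sum fun z _ => mul_le_mul_of_nonneg_right (hq x z) (hc z)
  have hβu : ∀ x, ∑ z, q x z * c z ≤ (1 - δ) * ∑ z, c z := fun x => by
    rw [Finset.mul_sum]
    exact Finset.sum_le_sum fun z _ => mul_le_mul_of_nonneg_right (hq' x z) (hc z)
  have hβ : ∀ x, 0 < ∑ z, q x z * c z := fun x => (mul_pos hδ hpos).trans_le (hβl x)
  -- Doeblin minorization: every row dominates `1 / r` times one probability vector that does not
  -- depend on `x`. This yields both comparisons below.
  have hlow : ∀ x z, δ / (1 - δ) * (c z / ∑ w, c w) ≤ q x z * c z / ∑ w, q x w * c w := by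
    intro x z
    rw [div_mul_div_comm]
    exact div_le_div₀ (mul_nonneg (hδ.le.trans (hq x z)) (hc z))
      (mul_le_mul_of_nonneg_right (hq x z) (hc z)) (hβ x) (hβu x)
  have hsum : ∀ x, ∑ z, q x z * c z / ∑ w, q x w * c w = 1 := fun x => by
    rw [← Finset.sum_div, div_self (hβ x).ne']
  have hcsum : ∑ z, c z / ∑ w, c w = 1 := by rw [← Finset.sum_div, div_self hpos.ne']
  refine ⟨hβ, fun x x' z => ?_, fun x x' z => ?_⟩
  · have h1 : q x z * c z / ∑ w, q x w * c w ≤ (1 - δ) / δ * (c z / ∑ w, c w) := by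
      rw [div_mul_div_comm]
      exact div_le_div₀ (mul_nonneg hδ1.le (hc z))
        (mul_le_mul_of_nonneg_right (hq' x z) (hc z)) (mul_pos hδ hpos) (hβl x)
    have h2 := mul_le_mul_of_nonneg_left (hlow x' z) (sq_nonneg ((1 - δ) / δ))
    refine h1.trans (le_trans (le_of_eq ?_) h2)
    field_simp
  · rw [one_div_div]
    generalize hk : (fun x z => q x z * c z / ∑ w, q x w * c w) = k at *
    have hk' : ∀ x z, q x z * c z / ∑ w, q x w * c w = k x z := fun x z => by rw [← hk]
    simp only [hk'] at *
    simp only [Fin.sum_univ_two] at hsum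
    generalize hd : (fun z => c z / ∑ w, c w) = d at *
    have hd' : ∀ z, c z / ∑ w, c w = d z := fun z => by rw [← hd]
    simp only [hd'] at *
    simp only [Fin.sum_univ_two] at hcsum
    have e : δ / (1 - δ) * d 0 + δ / (1 - δ) * d 1 = δ / (1 - δ) := by rw [← mul_add, hcsum, mul_one]
    rw [abs_le]
    have := hsum x
    have := hsum x'
    have := hlow x 0
    have := hlow x 1
    have := hlow x' 0
    have := hlow x' 1
    match z with
    | 0 => constructor <;> linarith
    | 1 => constructor <;> linarith

/-- Normalization: the weights of a hidden Markov posterior are those of a Markov chain. -/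
theorem exists_isMixingKernel {δ : ℝ} (hδ : 0 < δ) (n : ℕ) (q : ℕ → Fin 2 → Fin 2 → ℝ)
    (hq : ∀ i x z, δ ≤ q i x z) (hq' : ∀ i x z, q i x z ≤ 1 - δ) (hδ2 : δ ≤ 1 / 2)
    (a : ℕ → Fin 2 → ℝ) (ha : ∀ i z, 0 ≤ a i z) :
    ∃ K, IsMixingKernel ((1 - δ) / δ) K ∧ ∀ x F,
      chainSum n (fun i x z => q i x z * a i z) x F =
        chainSum n (fun i x z => q i x z * a i z) x (fun _ => 1) * chainSum n K x F := by
  have hr : 1 ≤ (1 - δ) / δ := by rw [le_div_iff₀ hδ]; linarith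
  induction n generalizing q a with
  | zero => exact ⟨_, isMixingKernel_uniform hr, fun x F => by simp [chainSum]⟩
  | succ n ih =>
    obtain ⟨K, hK, hKF⟩ := ih (fun i => q (i + 1)) (fun i => hq _) (fun i => hq' _)
      (fun i => a (i + 1)) (fun i => ha _)
    -- `b z` is the backward message: the total weight of all continuations from `z`. Tilting the
    -- first transition by `a 0 * b` normalizes it.
    set b : Fin 2 → ℝ := fun z =>
      chainSum n (fun i x z => q (i + 1) x z * a (i + 1) z) z (fun _ => 1) with hb
    have hb0 : ∀ z, 0 ≤ b z := fun z =>
      chainSum_nonneg (fun i x z => mul_nonneg (hδ.le.trans (hq _ _ _)) (ha _ _)) z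
        fun _ => zero_le_one
    have hexp : ∀ x F, chainSum (n + 1) (fun i x z => q i x z * a i z) x F =
        ∑ z, q 0 x z * (a 0 z * b z) * chainSum n K z (fun v => F (Fin.cons z v)) := by
      intro x F
      rw [chainSum]
      refine Finset.sum_congr rfl fun z _ => ?_
      rw [hKF z]
      simp only [hb]
      ring
    have hexp1 : ∀ x, chainSum (n + 1) (fun i x z => q i x z * a i z) x (fun _ => 1) =
        ∑ z, q 0 x z * (a 0 z * b z) := fun x => by
      rw [hexp]
      exact Finset.sum_congr rfl fun z _ => by rw [hK.chainSum_const, mul_one]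
    have hc0 : ∀ z, 0 ≤ a 0 z * b z := fun z => mul_nonneg (ha _ _) (hb0 z)
    rcases (Finset.sum_nonneg fun z (_ : z ∈ Finset.univ) => hc0 z).eq_or_lt with h0 | hpos
    · refine ⟨_, isMixingKernel_uniform hr, fun x F => ?_⟩
      have hz : ∀ z, a 0 z * b z = 0 := fun z =>
        (Finset.sum_eq_zero_iff_of_nonneg fun z _ => hc0 z).1 h0.symm z (Finset.mem_univ z)
      rw [hexp, hexp1]
      simp [hz]
    · obtain ⟨hβ, h2, h3⟩ := tilted_kernel_mixing hδ (hq 0) (hq' 0) hc0 hpos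
      refine ⟨_, hK.cons (k := fun x z => q 0 x z * (a 0 z * b z) / ∑ w, q 0 x w * (a 0 w * b w))
        (fun x z => div_nonneg (mul_nonneg (hδ.le.trans (hq _ _ _)) (hc0 z)) (hβ x).le)
        (fun x => by rw [← Finset.sum_div, div_self (hβ x).ne']) h2 h3, fun x F => ?_⟩
      rw [hexp, hexp1, chainSum, Finset.mul_sum]
      refine Finset.sum_congr rfl fun z _ => ?_
      have := (hβ x).ne'
      change _ = _ * (q 0 x z * (a 0 z * b z) / (∑ w, q 0 x w * (a 0 w * b w)) *
        chainSum n K z fun v => F (Fin.cons z v))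
      rw [← mul_assoc (∑ z, q 0 x z * (a 0 z * b z)), mul_div_cancel₀ _ this]

/-! ### Mean, variance and exponential moments of the number of mismatches -/

/-- The number of coordinates at which two labellings differ. -/
def mismatches {n : ℕ} (h v : Fin n → Fin 2) : ℝ := ∑ i, if h i ≠ v i then (1 : ℝ) else 0

theorem mismatches_nonneg {n : ℕ} (h v : Fin n → Fin 2) : 0 ≤ mismatches h v :=
  Finset.sum_nonneg fun i _ => by split_ifs <;> norm_num

theorem mismatches_le {n : ℕ} (h v : Fin n → Fin 2) : mismatches h v ≤ n := by
  refine (Finset.sum_le_sum (g := fun _ => (1 : ℝ)) fun i _ => ?_).trans (by simp)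
  split_ifs <;> norm_num

theorem mismatches_cons {n : ℕ} (h : Fin (n + 1) → Fin 2) (z : Fin 2) (v : Fin n → Fin 2) :
    mismatches h (Fin.cons z v) = (if h 0 ≠ z then 1 else 0) + mismatches (fun i => h i.succ) v := by
  simp only [mismatches, Fin.sum_univ_succ, Fin.cons_zero, Fin.cons_succ]

theorem IsMixingKernel.chainSum_mismatches_succ {r : ℝ} {K : ℕ → Fin 2 → Fin 2 → ℝ}
    (hK : IsMixingKernel r K) {n : ℕ} (h : Fin (n + 1) → Fin 2) (x : Fin 2) :
    chainSum (n + 1) K x (mismatches h) = ∑ z, K 0 x z * ((if h 0 ≠ z then 1 else 0) +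
      chainSum n (fun k => K (k + 1)) z (mismatches fun i => h i.succ)) := by
  simp only [chainSum, mismatches_cons, chainSum_add, hK.shift.chainSum_const]

/-- One step contracts by `1 - 1 / r` and adds at most `1` to the oscillation of the mean, and `r -
1` is the fixed point of `D ↦ (1 - 1 / r) * (1 + D)`. -/
theorem IsMixingKernel.abs_mean_sub_le {r : ℝ} (hr : 1 ≤ r) {K : ℕ → Fin 2 → Fin 2 → ℝ}
    (hK : IsMixingKernel r K) {n : ℕ} (h : Fin n → Fin 2) (x x' : Fin 2) :
    |chainSum n K x (mismatches h) - chainSum n K x' (mismatches h)| ≤ r - 1 := by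
  induction n generalizing K x x' with
  | zero => simpa [chainSum] using hr
  | succ n ih =>
    have ih' := ih hK.shift (fun i => h i.succ) 0 1
    simp only [hK.chainSum_mismatches_succ, Fin.sum_univ_two]
    set M := fun z => chainSum n (fun k => K (k + 1)) z (mismatches fun i => h i.succ) with hM
    change |M 0 - M 1| ≤ r - 1 at ih'
    set u : ℝ := (if h 0 ≠ 0 then 1 else 0) + M 0 with hu
    set w : ℝ := (if h 0 ≠ 1 then 1 else 0) + M 1 with hw
    have huw : |u - w| ≤ r := by
      rw [abs_le] at ih' ⊢
      rw [hu, hw]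
      constructor <;> split_ifs <;> linarith
    have h1 := hK.sum_eq_one 0 x
    have h2 := hK.sum_eq_one 0 x'
    rw [Fin.sum_univ_two] at h1 h2
    have e : K 0 x 0 * u + K 0 x 1 * w - (K 0 x' 0 * u + K 0 x' 1 * w) =
        (K 0 x 0 - K 0 x' 0) * (u - w) := by
      linear_combination w * h1 - w * h2
    rw [e, abs_mul]
    refine (mul_le_mul (hK.abs_sub_le 0 x x' 0) huw (abs_nonneg _) ?_).trans (le_of_eq ?_)
    · exact (abs_nonneg _).trans (hK.abs_sub_le 0 x x' 0)
    · field_simp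

/-- The variance splits into one-step contributions. Each is the variance of a two-point variable
whose values differ by at most `1 + (r - 1) = r`, hence at most `r ^ 2 / 4`. -/
theorem IsMixingKernel.variance_le {r : ℝ} (hr : 1 ≤ r) {K : ℕ → Fin 2 → Fin 2 → ℝ}
    (hK : IsMixingKernel r K) {n : ℕ} (h : Fin n → Fin 2) (x : Fin 2) :
    chainSum n K x (fun v => (mismatches h v - chainSum n K x (mismatches h)) ^ 2) ≤
      n * (r ^ 2 / 4) := by
  induction n generalizing K x with
  | zero => simp [chainSum]
  | succ n ih =>
    have ih' := ih hK.shift fun i => h i.succ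
    have hosc := hK.shift.abs_mean_sub_le hr (fun i => h i.succ) 0 1
    have hmean := hK.chainSum_mismatches_succ h x
    set m := chainSum (n + 1) K x (mismatches h)
    set M := fun z => chainSum n (fun k => K (k + 1)) z (mismatches fun i => h i.succ) with hM
    set B : Fin 2 → ℝ := fun z => if h 0 ≠ z then 1 else 0 with hB
    have hz : ∀ z, chainSum n (fun k => K (k + 1)) z
        (fun v => (mismatches h (Fin.cons z v) - m) ^ 2) ≤
          n * (r ^ 2 / 4) + (B z + M z - m) ^ 2 := by
      intro z
      have e : ∀ v, (mismatches h (Fin.cons z v) - m) ^ 2 =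
          (mismatches (fun i => h i.succ) v - M z) ^ 2 + (2 * (B z + M z - m) *
            (mismatches (fun i => h i.succ) v - M z) + (B z + M z - m) ^ 2) := fun v => by
        rw [mismatches_cons]; simp only [hB]; ring
      simp only [e, chainSum_add, chainSum_mul_left, chainSum_sub, hK.shift.chainSum_const]
      have := ih' z
      simp only [hM] at this ⊢
      linarith
    change |M 0 - M 1| ≤ r - 1 at hosc
    have h1 := hK.sum_eq_one 0 x
    simp only [chainSum]
    rw [Fin.sum_univ_two] at h1 hmean ⊢
    change m = K 0 x 0 * (B 0 + M 0) + K 0 x 1 * (B 1 + M 1) at hmean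
    have hd : (B 0 + M 0 - (B 1 + M 1)) ^ 2 ≤ r ^ 2 := by
      have h01 : |B 0 - B 1| ≤ 1 := by
        simp only [hB, abs_le]
        constructor <;> split_ifs <;> norm_num
      rw [abs_le] at h01 hosc
      apply sq_le_sq' <;> linarith
    have k0 := hK.nonneg 0 x 0
    have k1 := hK.nonneg 0 x 1
    have g0 := mul_le_mul_of_nonneg_left (hz 0) k0
    have g1 := mul_le_mul_of_nonneg_left (hz 1) k1
    have hk1 : K 0 x 1 = 1 - K 0 x 0 := by linarith
    have hkey : K 0 x 0 * (B 0 + M 0 - m) ^ 2 + K 0 x 1 * (B 1 + M 1 - m) ^ 2 =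
        K 0 x 0 * (1 - K 0 x 0) * (B 0 + M 0 - (B 1 + M 1)) ^ 2 := by
      rw [hmean, hk1]; ring
    have hk4 : K 0 x 0 * (1 - K 0 x 0) ≤ 1 / 4 := by nlinarith [sq_nonneg (K 0 x 0 - 1 / 2)]
    have := mul_le_mul hk4 hd (sq_nonneg _) (by norm_num)
    push_cast
    have e2 : (n : ℝ) * (r ^ 2 / 4) = K 0 x 0 * (n * (r ^ 2 / 4)) + K 0 x 1 * (n * (r ^ 2 / 4)) := by
      rw [← add_mul, h1, one_mul]
    linarith

/-- `P` adds up, over the steps, the mismatch probability minimized over the previous state. It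
bounds the mean from below, while each conditional mismatch probability is at most `r ^ 2` times its
term of `P`; so the exponential moment has a Poisson-type bound with parameter `r ^ 2 * P`, from any
start. -/
theorem IsMixingKernel.exists_mgf_le {r : ℝ} {K : ℕ → Fin 2 → Fin 2 → ℝ}
    (hK : IsMixingKernel r K) {n : ℕ} (h : Fin n → Fin 2) :
    ∃ P, (∀ x, P ≤ chainSum n K x (mismatches h)) ∧ ∀ x t, 0 ≤ t →
      chainSum n K x (fun v => Real.exp (t * mismatches h v)) ≤
        Real.exp ((Real.exp t - 1) * (r ^ 2 * P)) := by
  induction n generalizing K with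
  | zero => exact ⟨0, fun x => by simp [chainSum, mismatches], fun x t _ => by
      simp [chainSum, mismatches]⟩
  | succ n ih =>
    obtain ⟨P, hP, hmgf⟩ := ih hK.shift fun i => h i.succ
    -- `b` is the only state that disagrees with `h 0`; `c` is the agreeing one.
    obtain ⟨b, hb⟩ : ∃ b : Fin 2, ∀ z, h 0 ≠ z ↔ z = b := by
      generalize h 0 = u
      clear hP hmgf
      revert u
      decide
    obtain ⟨c, hc⟩ : ∃ c : Fin 2, c ≠ b := exists_ne b
    have hsum : ∀ F : Fin 2 → ℝ, ∑ z, F z = F b + F c := fun F => by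
      revert hc; revert b c; simp only [Fin.forall_fin_two]
      simp [Fin.sum_univ_two, add_comm]
    have hK1 : ∀ x, K 0 x b + K 0 x c = 1 := fun x => by rw [← hsum, hK.sum_eq_one]
    refine ⟨min (K 0 0 b) (K 0 1 b) + P, fun x => ?_, fun x t ht => ?_⟩
    · rw [hK.chainSum_mismatches_succ, hsum]
      simp only [hb, if_true, hc, if_false]
      have hx : min (K 0 0 b) (K 0 1 b) ≤ K 0 x b := by
        match x with
        | 0 => exact min_le_left _ _
        | 1 => exact min_le_right _ _
      have := mul_le_mul_of_nonneg_left (hP b) (hK.nonneg 0 x b)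
      have := mul_le_mul_of_nonneg_left (hP c) (hK.nonneg 0 x c)
      have e : P = K 0 x b * P + K 0 x c * P := by rw [← add_mul, hK1, one_mul]
      linarith
    · have hx : K 0 x b ≤ r ^ 2 * min (K 0 0 b) (K 0 1 b) := by
        rcases min_choice (K 0 0 b) (K 0 1 b) with e | e <;> rw [e] <;> exact hK.le_mul _ _ _ _
      have het : 0 ≤ Real.exp t - 1 := by linarith [Real.one_le_exp ht]
      rw [chainSum, hsum]
      simp only [mismatches_cons, hb, if_true, hc, if_false, zero_add, mul_add, mul_one,
        Real.exp_add, chainSum_mul_left]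
      have g0 := mul_le_mul_of_nonneg_left (hmgf b t ht)
        (mul_nonneg (hK.nonneg 0 x b) (Real.exp_pos t).le)
      have g1 := mul_le_mul_of_nonneg_left (hmgf c t ht) (hK.nonneg 0 x c)
      calc _ ≤ (1 + (Real.exp t - 1) * K 0 x b) * Real.exp ((Real.exp t - 1) * (r ^ 2 * P)) := by
            rw [show K 0 x c = 1 - K 0 x b by linarith [hK1 x]] at *
            linarith
        _ ≤ Real.exp ((Real.exp t - 1) * (r ^ 2 * min (K 0 0 b) (K 0 1 b))) *
              Real.exp ((Real.exp t - 1) * (r ^ 2 * P)) := by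
            refine mul_le_mul_of_nonneg_right ?_ (Real.exp_pos _).le
            have := Real.add_one_le_exp ((Real.exp t - 1) * (r ^ 2 * min (K 0 0 b) (K 0 1 b)))
            have := mul_le_mul_of_nonneg_left hx het
            linarith
        _ = _ := by rw [← Real.exp_add]

/-- The expected excess of the number of mismatches over `n / 2` is small in comparison with its
mean, if the latter is at most `n / 2`. -/
theorem IsMixingKernel.excess_le {r : ℝ} (hr : 1 ≤ r) {K : ℕ → Fin 2 → Fin 2 → ℝ}
    (hK : IsMixingKernel r K) {n : ℕ} (hn : 2 ≤ n) (h : Fin n → Fin 2) (x : Fin 2)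
    (hm : chainSum n K x (mismatches h) ≤ n / 2) :
    chainSum n K x (fun v => max (2 * mismatches h v - n) 0) ≤
      2 * Real.exp 1 * r ^ 2 * (r * Real.sqrt (Real.log 2 / (2 * (n : ℝ)))) ^ (1 - 2 / (n : ℝ)) *
        chainSum n K x (mismatches h) := by
  set m := chainSum n K x (mismatches h) with hmdef
  set T := chainSum n K x (fun v => max (2 * mismatches h v - n) 0) with hT
  set s := r * Real.sqrt (Real.log 2 / (2 * (n : ℝ))) with hs
  have hn0 : (0 : ℝ) < n := by positivity
  have hm0 : 0 ≤ m := chainSum_nonneg hK.nonneg x (mismatches_nonneg h)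
  have hT0 : 0 ≤ T := chainSum_nonneg hK.nonneg x fun v => le_max_right _ _
  have hr0 : 0 < r := by linarith
  have hlog : (1 / 2 : ℝ) ≤ Real.log 2 := by linarith [Real.log_two_gt_d9]
  have hs0 : 0 < s := mul_pos hr0 (Real.sqrt_pos.2 (by positivity))
  have hTm : T ≤ m := chainSum_mono hK.nonneg x fun v =>
    max_le (by linarith [mismatches_le h v]) (mismatches_nonneg h v)
  rcases hT0.eq_or_lt with hT00 | hTpos
  · rw [← hT00]; positivity
  have hmpos : 0 < m := hTpos.trans_le hTm
  have bound1 : T ≤ n * s := by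
    set A := chainSum n K x (fun v => |mismatches h v - m|) with hA
    have h1 : T ≤ A := by
      -- Since `m ≤ n / 2`, the excess is at most twice the positive part of the deviation from the
      -- mean, that is, `|d| + d`, and `d` has mean zero.
      have e : chainSum n K x (fun v => |mismatches h v - m| + (mismatches h v - m)) = A := by
        rw [chainSum_add, chainSum_sub, hK.chainSum_const]; simp [hA, hmdef]
      rw [← e]
      refine chainSum_mono hK.nonneg x fun v => max_le ?_ ?_
      · linarith [le_abs_self (mismatches h v - m)]
      · linarith [neg_abs_le (mismatches h v - m)]
    have h2 : A ^ 2 ≤ n * (r ^ 2 / 4) := by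
      refine le_trans ?_ (hK.variance_le hr h x)
      have : 0 ≤ chainSum n K x (fun v => (|mismatches h v - m| - A) ^ 2) :=
        chainSum_nonneg hK.nonneg x fun v => sq_nonneg _
      have e : ∀ v, (|mismatches h v - m| - A) ^ 2 =
          (mismatches h v - m) ^ 2 + ((-2 * A) * |mismatches h v - m| + A ^ 2) := fun v => by
        rw [sub_sq, sq_abs]; ring
      simp only [e, chainSum_add, chainSum_mul_left, hK.chainSum_const] at this
      rw [← hA] at this
      simp only [← hmdef]
      linarith
    have h3 : (n * s) ^ 2 = n * (r ^ 2 * (Real.log 2 / 2)) := by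
      rw [hs, mul_pow, mul_pow, Real.sq_sqrt (by positivity)]
      field_simp
    have h4 : A ^ 2 ≤ (n * s) ^ 2 := by
      rw [h3]
      refine h2.trans (mul_le_mul_of_nonneg_left ?_ hn0.le)
      nlinarith [sq_nonneg r]
    exact h1.trans (abs_le_of_sq_le_sq' h4 (by positivity)).2
  have bound2 : T ≤ n * (2 * Real.exp 1 * r ^ 2 * m / n) ^ ((n : ℝ) / 2) := by
    rcases le_total (2 * r ^ 2 * m / n) 1 with hle | hge
    · obtain ⟨P, hP, hmgf⟩ := hK.exists_mgf_le h
      set ρ := 2 * r ^ 2 * m / n with hρ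
      have hρ0 : 0 < ρ := by positivity
      -- With this `t` the exponent `(exp t - 1) * r ^ 2 * m` stays below `n / 2`, so Chernoff gives
      -- `(ρ * e) ^ (n / 2)`. When `ρ ≥ 1` the target base is at least `1` and `T ≤ n` suffices.
      set t := - Real.log ρ with ht
      have ht0 : 0 ≤ t := by have := Real.log_nonpos hρ0.le hle; linarith
      have het : Real.exp t = 1 / ρ := by rw [ht, Real.exp_neg, Real.exp_log hρ0, one_div]
      have h1 : T ≤ n * Real.exp (-(t * (n / 2))) *
          chainSum n K x (fun v => Real.exp (t * mismatches h v)) := by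
        rw [← chainSum_mul_left]
        refine chainSum_mono hK.nonneg x fun v => ?_
        rw [mul_assoc, ← Real.exp_add]
        refine max_le ?_ (by positivity)
        rcases le_total (2 * mismatches h v - n) 0 with h0 | h0
        · exact h0.trans (by positivity)
        · have : 1 ≤ Real.exp (-(t * (n / 2)) + t * mismatches h v) := by
            apply Real.one_le_exp
            have := mul_nonneg ht0 h0
            linarith
          nlinarith [mismatches_le h v]
      have h2 : chainSum n K x (fun v => Real.exp (t * mismatches h v)) ≤
          Real.exp (n / 2) := by
        refine (hmgf x t ht0).trans (Real.exp_le_exp.2 ?_)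
        have h3 : (Real.exp t - 1) * (r ^ 2 * P) ≤ (Real.exp t - 1) * (r ^ 2 * m) :=
          mul_le_mul_of_nonneg_left (mul_le_mul_of_nonneg_left (hP x) (sq_nonneg r))
            (by linarith [Real.one_le_exp ht0])
        have h4 : 1 / ρ * (r ^ 2 * m) = n / 2 := by rw [hρ]; field_simp
        rw [het] at h3
        rw [het]
        have : 0 ≤ r ^ 2 * m := by positivity
        linarith
      refine (h1.trans (mul_le_mul_of_nonneg_left h2 (by positivity))).trans (le_of_eq ?_)
      rw [show 2 * Real.exp 1 * r ^ 2 * m / n = ρ * Real.exp 1 by rw [hρ]; ring,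
        Real.mul_rpow hρ0.le (Real.exp_pos _).le, ← Real.exp_mul, one_mul,
        Real.rpow_def_of_pos hρ0, ht, mul_assoc]
      congr 3
      ring
    · have h1 : T ≤ n := by
        rw [← hK.chainSum_const n x (n : ℝ)]
        exact chainSum_mono hK.nonneg x fun v => max_le (by linarith [mismatches_le h v]) hn0.le
      have h2 : (1 : ℝ) ≤ (2 * Real.exp 1 * r ^ 2 * m / n) ^ ((n : ℝ) / 2) := by
        apply Real.one_le_rpow _ (by positivity)
        rw [show 2 * Real.exp 1 * r ^ 2 * m / n = Real.exp 1 * (2 * r ^ 2 * m / n) by ring]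
        nlinarith [Real.add_one_le_exp (1 : ℝ)]
      nlinarith
  set C := 2 * Real.exp 1 * r ^ 2 * m / n with hC
  have hC0 : 0 < C := by positivity
  have hq : 0 < T / n := by positivity
  have hq1 : T / n ≤ s := by rw [div_le_iff₀ hn0]; linarith
  have hq2 : T / n ≤ C ^ ((n : ℝ) / 2) := by rw [div_le_iff₀ hn0]; linarith
  have hexp : 0 ≤ 1 - 2 / (n : ℝ) := by
    have : 2 / (n : ℝ) ≤ 1 := by rw [div_le_one hn0]; exact_mod_cast hn
    linarith
  -- Interpolation: the power `2 / n` cancels the exponent `n / 2` of the Chernoff bound and leaves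
  -- `C`, linear in `m`.
  have hmain : T / n ≤ s ^ (1 - 2 / (n : ℝ)) * C := by
    calc T / n = (T / n) ^ (1 - 2 / (n : ℝ)) * (T / n) ^ (2 / (n : ℝ)) := by
          rw [← Real.rpow_add hq, sub_add_cancel, Real.rpow_one]
      _ ≤ s ^ (1 - 2 / (n : ℝ)) * (C ^ ((n : ℝ) / 2)) ^ (2 / (n : ℝ)) :=
          mul_le_mul (Real.rpow_le_rpow hq.le hq1 hexp)
            (Real.rpow_le_rpow hq.le hq2 (by positivity)) (by positivity) (by positivity)
      _ = s ^ (1 - 2 / (n : ℝ)) * C := by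
          rw [← Real.rpow_mul hC0.le, div_mul_div_comm, mul_comm (n : ℝ) 2,
            div_self (by positivity), Real.rpow_one]
  rw [div_le_iff₀ hn0] at hmain
  refine hmain.trans (le_of_eq ?_)
  rw [hC]
  field_simp

/-! ### The quadratic inequality for block sizes and signed sums -/

/-- The quadratic inequality behind the reduction to two blocks, for two pure blocks. -/
theorem sum_mul_abs_ge_of_pure {ι : Type*} (s : Finset ι) (c t : ι → ℝ)
    (ht : ∀ k ∈ s, |t k| ≤ c k) {a b : ℝ} (ha : 0 ≤ a) (hb : 0 ≤ b) :
    (a + b) ^ 2 - (∑ k ∈ s, c k) ^ 2 ≤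
      a * |(∑ k ∈ s, t k) - a - b| + b * |(∑ k ∈ s, t k) + a + b| +
        ∑ k ∈ s, c k * |a - b + (∑ k ∈ s, t k) - 2 * t k| := by
  set R := ∑ k ∈ s, c k with hR
  set M := ∑ k ∈ s, t k with hM
  have hc : ∀ k ∈ s, 0 ≤ c k := fun k hk => (abs_nonneg _).trans (ht k hk)
  have hcR : ∀ k ∈ s, c k ≤ R := fun k hk => Finset.single_le_sum hc hk
  have hMR : |M| ≤ R := (Finset.abs_sum_le_sum_abs _ _).trans (Finset.sum_le_sum ht)
  have hR0 : 0 ≤ R := Finset.sum_nonneg hc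
  have h1 := mul_le_mul_of_nonneg_left (neg_abs_le (M - a - b)) ha
  have h2 := mul_le_mul_of_nonneg_left (le_abs_self (M + a + b)) hb
  have hsum0 : 0 ≤ ∑ k ∈ s, c k * |a - b + M - 2 * t k| :=
    Finset.sum_nonneg fun k hk => mul_nonneg (hc k hk) (abs_nonneg _)
  rw [abs_le] at hMR
  -- The two pure terms already give `(a + b) ^ 2 - M * (a - b)`. If `M` and `a - b` have opposite
  -- signs nothing remains; otherwise the absolute values are dropped with the common sign.
  have key : M * (a - b) - R ^ 2 ≤ ∑ k ∈ s, c k * |a - b + M - 2 * t k| := by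
    have hpos : ∑ k ∈ s, c k * (a - b + M - 2 * t k) = R * (a - b + M) - 2 * ∑ k ∈ s, c k * t k := by
      rw [hR, Finset.sum_mul, Finset.mul_sum, ← Finset.sum_sub_distrib]
      exact Finset.sum_congr rfl fun k _ => by ring
    rcases le_total 0 (a - b) with hd | hd <;> rcases le_total 0 M with hm | hm
    · have h3 : 0 ≤ ∑ k ∈ s, (R * c k + R * t k - 2 * (c k * t k)) := by
        refine Finset.sum_nonneg fun k hk => ?_
        have := abs_le.1 (ht k hk)
        nlinarith [mul_nonneg (sub_nonneg.2 (hcR k hk)) (by linarith : 0 ≤ c k + t k),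
          mul_nonneg (hc k hk) (by linarith : 0 ≤ c k - t k)]
      rw [Finset.sum_sub_distrib, Finset.sum_add_distrib, ← Finset.mul_sum, ← Finset.mul_sum,
        ← Finset.mul_sum, ← hR, ← hM] at h3
      have h4 : ∑ k ∈ s, c k * (a - b + M - 2 * t k) ≤ ∑ k ∈ s, c k * |a - b + M - 2 * t k| :=
        Finset.sum_le_sum fun k hk => mul_le_mul_of_nonneg_left (le_abs_self _) (hc k hk)
      nlinarith [mul_le_mul_of_nonneg_right hMR.2 hd]
    · nlinarith [mul_nonneg hd (neg_nonneg.2 hm), sq_nonneg R]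
    · nlinarith [mul_nonneg (neg_nonneg.2 hd) hm, sq_nonneg R]
    · have h3 : 0 ≤ ∑ k ∈ s, (R * c k - R * t k + 2 * (c k * t k)) := by
        refine Finset.sum_nonneg fun k hk => ?_
        have := abs_le.1 (ht k hk)
        nlinarith [mul_nonneg (sub_nonneg.2 (hcR k hk)) (by linarith : 0 ≤ c k - t k),
          mul_nonneg (hc k hk) (by linarith : 0 ≤ c k + t k)]
      rw [Finset.sum_add_distrib, Finset.sum_sub_distrib, ← Finset.mul_sum, ← Finset.mul_sum,
        ← Finset.mul_sum, ← hR, ← hM] at h3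
      have h4 : -∑ k ∈ s, c k * (a - b + M - 2 * t k) ≤
          ∑ k ∈ s, c k * |a - b + M - 2 * t k| := by
        rw [← Finset.sum_neg_distrib]
        refine Finset.sum_le_sum fun k hk => ?_
        rw [← mul_neg]
        exact mul_le_mul_of_nonneg_left (neg_le_abs _) (hc k hk)
      nlinarith [mul_nonneg (neg_nonneg.2 hd) (by linarith : 0 ≤ R + M)]
  nlinarith

/-- Reduction to pure blocks `p = a`, `q = -b`: this replacement moves every absolute value by at
most `a - p + (b + q)`. Their weights add up to `n`, so the right side grows by at most `n` times
that amount, which is exactly the growth of the left side. -/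
theorem sum_mul_abs_ge {ι : Type*} (s : Finset ι) (c t : ι → ℝ)
    (ht : ∀ k ∈ s, |t k| ≤ c k) {a b p q N n : ℝ} (hp : |p| ≤ a) (hq : |q| ≤ b)
    (hN : p + q + ∑ k ∈ s, t k = N) (hn : a + b + ∑ k ∈ s, c k = n) :
    n * (a + b + p - q - n) ≤
      a * |N - 2 * p| + b * |N - 2 * q| + ∑ k ∈ s, c k * |N - 2 * t k| := by
  have ha : 0 ≤ a := (abs_nonneg _).trans hp
  have hb : 0 ≤ b := (abs_nonneg _).trans hq
  have hc : ∀ k ∈ s, 0 ≤ c k := fun k hk => (abs_nonneg _).trans (ht k hk)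
  have hpure := sum_mul_abs_ge_of_pure s c t ht ha hb
  set R := ∑ k ∈ s, c k with hR
  set M := ∑ k ∈ s, t k with hM
  rw [abs_le] at hp hq
  have hlip : ∀ u w : ℝ, u - w ≤ a - p + (b + q) → w - u ≤ a - p + (b + q) →
      |w| ≤ |u| + (a - p + (b + q)) := by
    intro u w h1 h2
    rw [abs_le]
    constructor <;> linarith [le_abs_self u, neg_abs_le u]
  have h1 := mul_le_mul_of_nonneg_left
    (hlip (N - 2 * p) (M - a - b) (by linarith) (by linarith)) ha
  have h2 := mul_le_mul_of_nonneg_left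
    (hlip (N - 2 * q) (M + a + b) (by linarith) (by linarith)) hb
  have h3 : ∑ k ∈ s, c k * |a - b + M - 2 * t k| ≤
      ∑ k ∈ s, c k * |N - 2 * t k| + R * (a - p + (b + q)) := by
    rw [hR, Finset.sum_mul, ← Finset.sum_add_distrib]
    refine Finset.sum_le_sum fun k hk => ?_
    rw [← mul_add]
    exact mul_le_mul_of_nonneg_left (hlip _ _ (by linarith) (by linarith)) (hc k hk)
  rw [← hn]
  nlinarith

/-! ### From partitions to two-block labellings -/

/-- The sign encoding of a label. -/
def labelSign (z : Fin 2) : ℝ := if z = 0 then 1 else -1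

theorem abs_labelSign (z : Fin 2) : |labelSign z| = 1 := by
  unfold labelSign; split_ifs <;> simp

theorem abs_sum_labelSign_le {n : ℕ} (x : Fin n → Fin 2) (C : Finset (Fin n)) :
    |∑ j ∈ C, labelSign (x j)| ≤ C.card := by
  refine (Finset.abs_sum_le_sum_abs _ _).trans ?_
  simp [abs_labelSign]

theorem card_inter_fiber_zero {n : ℕ} (x : Fin n → Fin 2) (C : Finset (Fin n)) :
    2 * ((C ∩ Finset.univ.filter fun j => x j = 0).card : ℝ) =
      C.card + ∑ j ∈ C, labelSign (x j) := by
  rw [Finset.inter_filter, Finset.inter_univ, Finset.card_filter, Finset.card_eq_sum_ones]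
  push_cast
  rw [Finset.mul_sum, ← Finset.sum_add_distrib]
  refine Finset.sum_congr rfl fun j _ => ?_
  unfold labelSign; split_ifs <;> norm_num

theorem card_inter_fiber_one {n : ℕ} (x : Fin n → Fin 2) (C : Finset (Fin n)) :
    2 * ((C ∩ Finset.univ.filter fun j => x j = 1).card : ℝ) =
      C.card - ∑ j ∈ C, labelSign (x j) := by
  rw [Finset.inter_filter, Finset.inter_univ, Finset.card_filter, Finset.card_eq_sum_ones]
  push_cast
  rw [Finset.mul_sum, ← Finset.sum_sub_distrib]
  refine Finset.sum_congr rfl fun j _ => ?_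
  rcases Fin.exists_fin_two.1 ⟨x j, rfl⟩ with e | e <;> rw [e] <;> norm_num [labelSign]

/-- The labelling which separates the block of `i` from the other blocks. -/
def blockLabel {n : ℕ} (A : Partition n) (i : Fin n) : Fin n → Fin 2 :=
  fun j => if j ∈ A.part i then 0 else 1

theorem sub_two_mul_mismatches_blockLabel {n : ℕ} (A : Partition n) (i : Fin n)
    (x : Fin n → Fin 2) :
    (n : ℝ) - 2 * mismatches (blockLabel A i) x =
      2 * ∑ j ∈ A.part i, labelSign (x j) - ∑ j, labelSign (x j) := by
  have h1 : (n : ℝ) = ∑ _j : Fin n, (1 : ℝ) := by simp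
  have h2 : ∑ j ∈ A.part i, labelSign (x j) =
      ∑ j, if j ∈ A.part i then labelSign (x j) else 0 := by
    rw [← Finset.sum_filter]; simp
  rw [h1, h2, mismatches, Finset.mul_sum, Finset.mul_sum, ← Finset.sum_sub_distrib,
    ← Finset.sum_sub_distrib]
  refine Finset.sum_congr rfl fun j _ => ?_
  unfold blockLabel labelSign
  rcases Fin.exists_fin_two.1 ⟨x j, rfl⟩ with e | e <;> rw [e] <;> split_ifs <;> simp_all <;>
    norm_num

theorem max_eq_half_add_abs (u n : ℝ) : max u (n - u) = (n + |n - 2 * u|) / 2 := by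
  rcases le_total u (n - u) with h | h
  · rw [max_eq_right h, abs_of_nonneg (by linarith)]; ring
  · rw [max_eq_left h, abs_of_nonpos (by linarith)]; ring

/-- A uniformly drawn point selects a block with probability proportional to its size; this produces
the weights `c k` of the quadratic inequality. -/
theorem sum_part {n : ℕ} (A : Partition n) (f : Finset (Fin n) → ℝ) :
    ∑ i, f (A.part i) = ∑ C ∈ A.parts, (C.card : ℝ) * f C := by
  rw [← Finset.sum_fiberwise_of_maps_to (s := Finset.univ) (t := A.parts) (g := A.part)
    fun i _ => A.part_mem.2 (Finset.mem_univ i)]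
  refine Finset.sum_congr rfl fun C hC => ?_
  have e : Finset.univ.filter (fun i => A.part i = C) = C := by
    ext i
    simp [A.part_eq_iff_mem hC]
  rw [e, Finset.sum_congr rfl fun i hi => by rw [(A.part_eq_iff_mem hC).2 hi]]
  simp

theorem mem_parts_labelPartition {J n : ℕ} {x : Fin n → Fin J} {C : Finset (Fin n)} :
    C ∈ (labelPartition x).parts ↔
      ∃ i, C = Finset.univ.filter fun j => x j = x i := by
  classical
  have hpart : ∀ i, (labelPartition x).part i = Finset.univ.filter fun j => x j = x i := by
    intro i
    ext j
    unfold labelPartition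
    rw [Finpartition.mem_part_ofSetoid_iff_rel, Setoid.ker_def]
    simp [eq_comm]
  constructor
  · intro hC
    obtain ⟨i, hi⟩ := Finpartition.nonempty_of_mem_parts _ hC
    exact ⟨i, by rw [← hpart, (labelPartition x).part_eq_of_mem hC hi]⟩
  · rintro ⟨i, rfl⟩
    rw [← hpart]
    exact Finpartition.part_mem _ |>.2 (Finset.mem_univ i)

/-- The labelling induces at most two blocks, so an optimal matching has at most two edges. Sizes
and signed sums express both its overlap and the right side, and the claim becomes `sum_mul_abs_ge`.
-/
theorem card_mul_maxOverlap_le {n : ℕ} (A : Partition n) (x : Fin n → Fin 2) :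
    (n : ℝ) * maxOverlap A (labelPartition x) ≤
      ∑ i, max (mismatches (blockLabel A i) x) (n - mismatches (blockLabel A i) x) := by
  classical
  set c : Finset (Fin n) → ℝ := fun C => C.card with hc
  set t : Finset (Fin n) → ℝ := fun C => ∑ j ∈ C, labelSign (x j) with ht
  set N := ∑ j, labelSign (x j) with hN
  have htc : ∀ C, |t C| ≤ c C := abs_sum_labelSign_le x
  have hcsum : ∑ C ∈ A.parts, c C = n := by
    simp only [hc]; rw [← Nat.cast_sum, A.sum_card_parts]; simp
  have htsum : ∑ C ∈ A.parts, t C = N := by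
    have h1 : ∀ C ∈ A.parts, t C = ∑ i with A.part i = C, labelSign (x i) := fun C hC => by
      refine Finset.sum_congr ?_ fun _ _ => rfl
      ext i
      simp [A.part_eq_iff_mem hC]
    rw [Finset.sum_congr rfl h1]
    exact Finset.sum_fiberwise_of_maps_to (fun i _ => A.part_mem.2 (Finset.mem_univ i)) _
  set S := ∑ C ∈ A.parts, c C * |N - 2 * t C| with hS
  have hrhs : ∑ i, max (mismatches (blockLabel A i) x) (n - mismatches (blockLabel A i) x) =
      (n ^ 2 + S) / 2 := by
    simp only [max_eq_half_add_abs, sub_two_mul_mismatches_blockLabel]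
    rw [← Finset.sum_div, Finset.sum_add_distrib,
      sum_part A fun C => |2 * ∑ j ∈ C, labelSign (x j) - ∑ j, labelSign (x j)|]
    simp only [Finset.sum_const, Finset.card_univ, Fintype.card_fin, nsmul_eq_mul, hS, ht, hc, hN]
    congr 2
    · ring
    · exact Finset.sum_congr rfl fun C _ => by rw [abs_sub_comm]
  have hS0 : 0 ≤ S := Finset.sum_nonneg fun C _ => mul_nonneg (Nat.cast_nonneg _) (abs_nonneg _)
  have hn0 : (0 : ℝ) ≤ n := Nat.cast_nonneg n
  have hsingle0 : ∀ a ∈ A.parts, n * (c a + t a) ≤ n ^ 2 + S := fun a ha => by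
    -- With only one edge, an empty block (`b = q = 0`) takes the place of the missing one.
    have := sum_mul_abs_ge (A.parts.erase a) c t (fun k _ => htc k) (b := 0) (q := 0) (N := N)
      (n := n) (htc a) (by simp) (by rw [← htsum, ← Finset.add_sum_erase _ _ ha]; ring)
      (by rw [← hcsum, ← Finset.add_sum_erase _ _ ha]; ring)
    rw [hS, ← Finset.add_sum_erase _ _ ha]
    linarith
  have hsingle1 : ∀ b ∈ A.parts, n * (c b - t b) ≤ n ^ 2 + S := fun b hb => by
    have := sum_mul_abs_ge (A.parts.erase b) c t (fun k _ => htc k) (a := 0) (p := 0) (N := N)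
      (n := n) (by simp) (htc b) (by rw [← htsum, ← Finset.add_sum_erase _ _ hb]; ring)
      (by rw [← hcsum, ← Finset.add_sum_erase _ _ hb]; ring)
    rw [hS, ← Finset.add_sum_erase _ _ hb]
    linarith
  have hpair : ∀ a ∈ A.parts, ∀ b ∈ A.parts, a ≠ b →
      n * (c a + t a + (c b - t b)) ≤ n ^ 2 + S := fun a ha b hb hab => by
    have hb' : b ∈ A.parts.erase a := Finset.mem_erase.2 ⟨hab.symm, hb⟩
    have := sum_mul_abs_ge ((A.parts.erase a).erase b) c t (fun k _ => htc k) (N := N)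
      (n := n) (htc a) (htc b)
      (by rw [← htsum, ← Finset.add_sum_erase _ _ ha, ← Finset.add_sum_erase _ _ hb']; ring)
      (by rw [← hcsum, ← Finset.add_sum_erase _ _ ha, ← Finset.add_sum_erase _ _ hb']; ring)
    rw [hS, ← Finset.add_sum_erase _ _ ha, ← Finset.add_sum_erase _ _ hb']
    linarith
  rw [hrhs]
  obtain ⟨M, hM, hMmax⟩ := Finset.exists_mem_eq_sup
    (Finset.univ.filter (IsMatching A (labelPartition x)))
    ⟨∅, by simp [IsMatching]⟩ fun M => ∑ e ∈ M, (e.1 ∩ e.2).card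
  have hover : maxOverlap A (labelPartition x) = ∑ e ∈ M, (e.1 ∩ e.2).card := by
    rw [← hMmax]; unfold maxOverlap; congr!
  obtain ⟨hMsub, hMinj⟩ := (Finset.mem_filter.1 hM).2
  have hmem : ∀ e ∈ M, e.1 ∈ A.parts ∧ ((e.2 = Finset.univ.filter fun j => x j = 0) ∨
      e.2 = Finset.univ.filter fun j => x j = 1) := fun e he => by
    obtain ⟨h1, h2⟩ := Finset.mem_product.1 (hMsub he)
    obtain ⟨i, hi⟩ := mem_parts_labelPartition.1 h2
    refine ⟨h1, ?_⟩
    rcases Fin.exists_fin_two.1 ⟨x i, rfl⟩ with e' | e' <;> rw [e'] at hi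
    exacts [Or.inl hi, Or.inr hi]
  have hdisj : ∀ e ∈ M, ∀ e' ∈ M, e.2 = e'.2 → e = e' := fun e he e' he' h =>
    hMinj e he e' he' (Or.inr h)
  rw [hover, ← Finset.sum_filter_add_sum_filter_not M
    fun e => e.2 = Finset.univ.filter fun j => x j = 0]
  have hM0 : ∀ e ∈ M.filter fun e => e.2 = Finset.univ.filter fun j => x j = 0,
      e.1 ∈ A.parts ∧ e ∈ M ∧ 2 * ((e.1 ∩ e.2).card : ℝ) = c e.1 + t e.1 := fun e he => by
    obtain ⟨h1, h2⟩ := Finset.mem_filter.1 he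
    exact ⟨(hmem e h1).1, h1, by rw [h2]; exact card_inter_fiber_zero x e.1⟩
  have hM1 : ∀ e ∈ M.filter fun e => ¬ e.2 = Finset.univ.filter fun j => x j = 0,
      e.1 ∈ A.parts ∧ e ∈ M ∧ 2 * ((e.1 ∩ e.2).card : ℝ) = c e.1 - t e.1 := fun e he => by
    obtain ⟨h1, h2⟩ := Finset.mem_filter.1 he
    exact ⟨(hmem e h1).1, h1, by
      rw [(hmem e h1).2.resolve_left h2]; exact card_inter_fiber_one x e.1⟩
  have hc0 : (M.filter fun e => e.2 = Finset.univ.filter fun j => x j = 0).card ≤ 1 :=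
    Finset.card_le_one.2 fun e he e' he' => hdisj e (hM0 e he).2.1 e' (hM0 e' he').2.1
      ((Finset.mem_filter.1 he).2.trans (Finset.mem_filter.1 he').2.symm)
  have hc1 : (M.filter fun e => ¬ e.2 = Finset.univ.filter fun j => x j = 0).card ≤ 1 :=
    Finset.card_le_one.2 fun e he e' he' => hdisj e (hM1 e he).2.1 e' (hM1 e' he').2.1
      (((hmem e (hM1 e he).2.1).2.resolve_left (Finset.mem_filter.1 he).2).trans
        ((hmem e' (hM1 e' he').2.1).2.resolve_left (Finset.mem_filter.1 he').2).symm)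
  have hne : ∀ e ∈ M.filter (fun e => e.2 = Finset.univ.filter fun j => x j = 0),
      ∀ e' ∈ M.filter (fun e => ¬ e.2 = Finset.univ.filter fun j => x j = 0), e.1 ≠ e'.1 := by
    intro e he e' he' h
    have := hMinj e (hM0 e he).2.1 e' (hM1 e' he').2.1 (Or.inl h)
    rw [this] at he
    exact (Finset.mem_filter.1 he').2 (Finset.mem_filter.1 he).2
  rw [Finset.card_le_one_iff_subset_singleton] at hc0 hc1
  obtain ⟨e0, hc0⟩ := hc0
  obtain ⟨e1, hc1⟩ := hc1
  generalize (M.filter fun e => e.2 = Finset.univ.filter fun j => x j = 0) = M0 at *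
  generalize (M.filter fun e => ¬ e.2 = Finset.univ.filter fun j => x j = 0) = M1 at *
  push_cast
  rcases Finset.subset_singleton_iff.1 hc0 with rfl | rfl <;>
    rcases Finset.subset_singleton_iff.1 hc1 with rfl | rfl
  · simp only [Finset.sum_empty]
    nlinarith
  · obtain ⟨h1, -, h2⟩ := hM1 e1 (Finset.mem_singleton_self _)
    have := hsingle1 _ h1
    rw [← h2] at this
    simp only [Finset.sum_empty, Finset.sum_singleton]
    linarith
  · obtain ⟨h1, -, h2⟩ := hM0 e0 (Finset.mem_singleton_self _)
    have := hsingle0 _ h1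
    rw [← h2] at this
    simp only [Finset.sum_empty, Finset.sum_singleton]
    linarith
  · obtain ⟨h1, -, h2⟩ := hM0 e0 (Finset.mem_singleton_self _)
    obtain ⟨h1', -, h2'⟩ := hM1 e1 (Finset.mem_singleton_self _)
    have := hpair _ h1 _ h1' (hne _ (Finset.mem_singleton_self _) _ (Finset.mem_singleton_self _))
    rw [← h2, ← h2'] at this
    simp only [Finset.sum_singleton]
    linarith

theorem sum_min_mismatches_le_loss {n : ℕ} (hn : 1 ≤ n) (A : Partition n) (x : Fin n → Fin 2) :
    (1 / (n : ℝ)) * ((1 / (n : ℝ)) *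
      ∑ i, min (mismatches (blockLabel A i) x) (n - mismatches (blockLabel A i) x)) ≤
      loss A (labelPartition x) := by
  have hn0 : (0 : ℝ) < n := by positivity
  have h := card_mul_maxOverlap_le A x
  have e : ∑ i, max (mismatches (blockLabel A i) x) (n - mismatches (blockLabel A i) x) +
      ∑ i, min (mismatches (blockLabel A i) x) (n - mismatches (blockLabel A i) x) = n * n := by
    rw [← Finset.sum_add_distrib]
    simp [max_add_min]
  rw [loss, ← mul_assoc, ← sub_nonneg]
  have h2 : 0 ≤ 1 / (n : ℝ) * (1 / n) * (n * n - n * maxOverlap A (labelPartition x) -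
      ∑ i, min (mismatches (blockLabel A i) x) (n - mismatches (blockLabel A i) x)) :=
    mul_nonneg (by positivity) (by linarith)
  refine h2.trans (le_of_eq ?_)
  field_simp

theorem loss_nonneg {n : ℕ} (hn : 1 ≤ n) (A : Partition n) (x : Fin n → Fin 2) :
    0 ≤ loss A (labelPartition x) :=
  le_trans (mul_nonneg (by positivity) (mul_nonneg (by positivity) (Finset.sum_nonneg fun i _ =>
    le_min (mismatches_nonneg _ _) (sub_nonneg.2 (mismatches_le _ _)))))
    (sum_min_mismatches_le_loss hn A x)

/-- Matching the fibres with equal labels gives total overlap equal to the number of agreements. -/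
theorem loss_labelPartition_le {n : ℕ} (hn : 1 ≤ n) (h x : Fin n → Fin 2) :
    loss (labelPartition h) (labelPartition x) ≤ (1 / (n : ℝ)) * mismatches h x := by
  classical
  have hn0 : (0 : ℝ) < n := by positivity
  set fib : (Fin n → Fin 2) → Fin 2 → Finset (Fin n) := fun v z =>
    Finset.univ.filter fun j => v j = z with hfib
  have hfm : ∀ v z j, j ∈ fib v z ↔ v j = z := fun v z j => by simp [hfib]
  have hinj : ∀ v z z', (fib v z).Nonempty → fib v z = fib v z' → z = z' := by
    rintro v z z' ⟨j, hj⟩ h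
    rw [← (hfm v z j).1 hj, (hfm v z' j).1 (h ▸ hj)]
  have hparts : ∀ v z, (fib v z).Nonempty → fib v z ∈ (labelPartition v).parts := by
    rintro v z ⟨j, hj⟩
    exact mem_parts_labelPartition.2 ⟨j, by rw [(hfm v z j).1 hj]⟩
  -- Only labels used by both are matched, since an empty fibre is not a block; the omitted labels
  -- contribute no overlap.
  set Z := Finset.univ.filter fun z => (fib h z).Nonempty ∧ (fib x z).Nonempty with hZ
  have hZm : ∀ z, z ∈ Z ↔ (fib h z).Nonempty ∧ (fib x z).Nonempty := fun z => by simp [hZ]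
  set M := Z.image fun z => (fib h z, fib x z) with hMdef
  have hM : IsMatching (labelPartition h) (labelPartition x) M := by
    constructor
    · intro e he
      obtain ⟨z, hz, rfl⟩ := Finset.mem_image.1 he
      exact Finset.mem_product.2 ⟨hparts h z ((hZm z).1 hz).1, hparts x z ((hZm z).1 hz).2⟩
    · intro e he e' he' hee
      obtain ⟨z, hz, rfl⟩ := Finset.mem_image.1 he
      obtain ⟨z', hz', rfl⟩ := Finset.mem_image.1 he'
      have : z = z' := hee.elim (hinj h z z' ((hZm z).1 hz).1) (hinj x z z' ((hZm z).1 hz).2)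
      rw [this]
  have hle : ∑ e ∈ M, (e.1 ∩ e.2).card ≤ maxOverlap (labelPartition h) (labelPartition x) := by
    unfold maxOverlap
    exact Finset.le_sup (f := fun M => ∑ e ∈ M, (e.1 ∩ e.2).card)
      (Finset.mem_filter.2 ⟨Finset.mem_univ _, hM⟩)
  have hsum : ∑ e ∈ M, (e.1 ∩ e.2).card = (Finset.univ.filter fun j => h j = x j).card := by
    rw [hMdef, Finset.sum_image fun z hz z' _ e =>
      hinj h z z' ((hZm z).1 hz).1 (Prod.ext_iff.1 e).1]
    rw [Finset.sum_subset (Finset.subset_univ Z)]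
    · rw [← Finset.card_biUnion]
      · congr 1
        ext j
        simp [hfm, eq_comm]
      · intro z _ z' _ hzz
        refine Finset.disjoint_left.2 fun j hj hj' => hzz ?_
        rw [← (hfm h z j).1 (Finset.mem_inter.1 hj).1, ← (hfm h z' j).1 (Finset.mem_inter.1 hj').1]
    · intro z _ hz
      by_contra hne
      obtain ⟨j, hj⟩ := Finset.card_pos.1 (Nat.pos_of_ne_zero hne)
      exact hz ((hZm z).2 ⟨⟨j, (Finset.mem_inter.1 hj).1⟩, ⟨j, (Finset.mem_inter.1 hj).2⟩⟩)
  have hmis : mismatches h x + (Finset.univ.filter fun j => h j = x j).card = n := by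
    rw [mismatches, Finset.card_filter]
    push_cast
    rw [← Finset.sum_add_distrib, Finset.sum_congr rfl (g := fun _ => (1 : ℝ))]
    · simp
    · intro j _
      by_cases e : h j = x j <;> simp [e]
  rw [loss, ← sub_nonneg]
  have h1 : ((Finset.univ.filter fun j => h j = x j).card : ℝ) ≤
      maxOverlap (labelPartition h) (labelPartition x) := by
    rw [← hsum]; exact_mod_cast hle
  have h2 : 0 ≤ 1 / (n : ℝ) * (mismatches h x - n +
      maxOverlap (labelPartition h) (labelPartition x)) :=
    mul_nonneg (by positivity) (by linarith)
  refine h2.trans (le_of_eq ?_)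
  field_simp
  ring

/-! ### Comparison under the posterior chain -/

theorem mismatches_one_sub {n : ℕ} (h v : Fin n → Fin 2) :
    mismatches (fun i => 1 - h i) v = n - mismatches h v := by
  have h1 : (n : ℝ) = ∑ _j : Fin n, (1 : ℝ) := by simp
  rw [h1, mismatches, mismatches, ← Finset.sum_sub_distrib]
  refine Finset.sum_congr rfl fun i _ => ?_
  generalize h i = a
  generalize v i = b
  have : 1 - a ≠ b ↔ ¬ a ≠ b := by revert a b; decide
  by_cases e : a ≠ b <;> simp [this, e]

/-- Conditionally on the observations, a two-block clustering is almost as hard as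
classification. -/
theorem IsMixingKernel.exists_le_min {r : ℝ} (hr : 1 ≤ r) {K : ℕ → Fin 2 → Fin 2 → ℝ}
    (hK : IsMixingKernel r K) {n : ℕ} (hn : 2 ≤ n) (h : Fin n → Fin 2) (x : Fin 2) :
    ∃ h' : Fin n → Fin 2,
      (1 - 2 * Real.exp 1 * r ^ 2 *
          (r * Real.sqrt (Real.log 2 / (2 * (n : ℝ)))) ^ (1 - 2 / (n : ℝ))) *
        chainSum n K x (mismatches h') ≤
      chainSum n K x (fun v => min (mismatches h v) (n - mismatches h v)) := by
  have key : ∀ g : Fin n → Fin 2, chainSum n K x (mismatches g) ≤ n / 2 →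
      (1 - 2 * Real.exp 1 * r ^ 2 *
          (r * Real.sqrt (Real.log 2 / (2 * (n : ℝ)))) ^ (1 - 2 / (n : ℝ))) *
        chainSum n K x (mismatches g) ≤
      chainSum n K x (fun v => min (mismatches g v) (n - mismatches g v)) := by
    intro g hg
    have h1 := hK.excess_le hr hn g x hg
    have e : ∀ v, min (mismatches g v) (n - mismatches g v) =
        mismatches g v - max (2 * mismatches g v - n) 0 := fun v => by
      rcases le_total (2 * mismatches g v - n) 0 with h0 | h0
      · rw [max_eq_right h0, min_eq_left (by linarith), sub_zero]
      · rw [max_eq_left h0, min_eq_right (by linarith)]; ring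
    simp only [e, chainSum_sub]
    change _ ≤ chainSum n K x (mismatches g) - _
    linarith
  -- Exchanging the two labels turns `m` into `n - m` and leaves the minimum unchanged, so the mean
  -- may be taken at most `n / 2`.
  rcases le_total (chainSum n K x (mismatches h)) (n / 2) with hm | hm
  · exact ⟨h, key h hm⟩
  · refine ⟨fun i => 1 - h i, (key (fun i => 1 - h i) ?_).trans (le_of_eq ?_)⟩
    · rw [show mismatches (fun i => 1 - h i) = fun v => n - mismatches h v from
        funext fun v => mismatches_one_sub h v, chainSum_sub, hK.chainSum_const]
      linarith
    · simp only [mismatches_one_sub, sub_sub_cancel, min_comm]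

theorem IsMixingKernel.le_expected_loss {δ : ℝ} (hδ : 0 < δ) (hδ2 : δ ≤ 1 / 2)
    {K : ℕ → Fin 2 → Fin 2 → ℝ} (hK : IsMixingKernel ((1 - δ) / δ) K) {n : ℕ} (hn : 2 ≤ n)
    (hα : alphaTilde δ n ≤ 1) (x : Fin 2) (A : Partition n) {h : Fin n → Fin 2}
    (hmin : ∀ h', chainSum n K x (mismatches h) ≤ chainSum n K x (mismatches h')) :
    (1 - alphaTilde δ n) * (1 / (n : ℝ) * chainSum n K x (mismatches h)) ≤
      chainSum n K x (fun v => loss A (labelPartition v)) := by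
  have hr : 1 ≤ (1 - δ) / δ := by rw [le_div_iff₀ hδ]; linarith
  have hn0 : (0 : ℝ) < n := by positivity
  -- The argument yields the factor `r ^ 2`; `alphaTilde` has the weaker `r ^ 4`.
  have hα' : 2 * Real.exp 1 * ((1 - δ) / δ) ^ 2 *
      ((1 - δ) / δ * Real.sqrt (Real.log 2 / (2 * (n : ℝ)))) ^ (1 - 2 / (n : ℝ)) ≤
        alphaTilde δ n := by
    unfold alphaTilde
    gcongr 2 * Real.exp 1 * ?_ * _
    exact pow_le_pow_right₀ hr (by norm_num)
  have hi : ∀ i, (1 - alphaTilde δ n) * chainSum n K x (mismatches h) ≤ chainSum n K x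
      (fun v => min (mismatches (blockLabel A i) v) (n - mismatches (blockLabel A i) v)) := by
    intro i
    obtain ⟨h', hh'⟩ := hK.exists_le_min hr hn (blockLabel A i) x
    have h0 : 0 ≤ chainSum n K x (mismatches h') :=
      chainSum_nonneg hK.nonneg x (mismatches_nonneg h')
    refine le_trans ?_ hh'
    exact (mul_le_mul_of_nonneg_left (hmin h') (by linarith)).trans
      (mul_le_mul_of_nonneg_right (by linarith) h0)
  refine le_trans ?_ (chainSum_mono hK.nonneg x
    (sum_min_mismatches_le_loss (by omega : 1 ≤ n) A))
  rw [chainSum_mul_left, chainSum_mul_left]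
  have e : chainSum n K x (fun v => ∑ i, min (mismatches (blockLabel A i) v)
      (n - mismatches (blockLabel A i) v)) = ∑ i, chainSum n K x
      (fun v => min (mismatches (blockLabel A i) v) (n - mismatches (blockLabel A i) v)) := by
    simp only [chainSum_eq_sum, Finset.mul_sum]
    exact Finset.sum_comm
  rw [e]
  have hsum := Finset.sum_le_sum fun i (_ : i ∈ Finset.univ) => hi i
  simp only [Finset.sum_const, Finset.card_univ, Fintype.card_fin, nsmul_eq_mul] at hsum
  rw [show (1 - alphaTilde δ n) * (1 / (n : ℝ) * chainSum n K x (mismatches h)) =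
    1 / (n : ℝ) * (1 / n * (n * ((1 - alphaTilde δ n) * chainSum n K x (mismatches h)))) by
      field_simp]
  gcongr

/-! ### Risks as integrals of posterior sums -/

theorem pi_withDensity {ι Ω : Type*} [Fintype ι] [MeasurableSpace Ω] (μ : Measure Ω)
    [IsProbabilityMeasure μ] (g : ι → Ω → ℝ≥0∞) (hg : ∀ i, Measurable (g i))
    [∀ i, SigmaFinite (μ.withDensity (g i))] :
    Measure.pi (fun i => μ.withDensity (g i)) =
      (Measure.pi fun _ => μ).withDensity fun y => ∏ i, g i (y i) := by
  refine Measure.pi_eq fun s hs => ?_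
  rw [withDensity_apply _ (MeasurableSet.univ_pi hs), ← lintegral_indicator
    (MeasurableSet.univ_pi hs)]
  have e : (Set.univ.pi s).indicator (fun y => ∏ i, g i (y i)) =
      fun y => ∏ i, (s i).indicator (g i) (y i) := by
    funext y
    by_cases hy : y ∈ Set.univ.pi s
    · rw [Set.indicator_of_mem hy]
      exact Finset.prod_congr rfl fun i _ => (Set.indicator_of_mem (hy i trivial) _).symm
    · rw [Set.indicator_of_notMem hy]
      obtain ⟨i, hi⟩ : ∃ i, y i ∉ s i := by simpa using hy
      exact (Finset.prod_eq_zero (Finset.mem_univ i) (Set.indicator_of_notMem hi _)).symm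
  have hgi : ∀ i, Measurable ((s i).indicator (g i)) := fun i => (hg i).indicator (hs i)
  have hind := ProbabilityTheory.iIndepFun_pi (μ := fun _ : ι => μ)
    (X := fun i => (s i).indicator (g i)) fun i => (hgi i).aemeasurable
  rw [e]
  refine (ProbabilityTheory.lintegral_prod_eq_prod_lintegral_of_indepFun Finset.univ
    (fun i (y : ι → Ω) => (s i).indicator (g i) (y i)) hind fun i =>
      (hgi i).comp (measurable_pi_apply i)).trans ?_
  refine Finset.prod_congr rfl fun i _ => ?_
  rw [withDensity_apply _ (hs i), ← lintegral_indicator (hs i)]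
  exact (measurePreserving_eval (fun _ : ι => μ) i).lintegral_comp (hgi i)

variable {𝕐 : Type*} [MeasurableSpace 𝕐] {L : Measure 𝕐}

/-- The equal mixture of the two emission distributions. -/
def Param.mixture (θ : Param 2 𝕐 L) : Measure 𝕐 :=
  (2⁻¹ : ℝ≥0∞) • (θ.emission 0 + θ.emission 1)

instance (θ : Param 2 𝕐 L) : IsProbabilityMeasure θ.mixture :=
  ⟨by simp [Param.mixture, ENNReal.inv_two_add_inv_two]⟩

theorem Param.emission_absolutelyContinuous (θ : Param 2 𝕐 L) (x : Fin 2) :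
    θ.emission x ≪ θ.mixture := by
  refine Measure.AbsolutelyContinuous.mk fun s _ hs => ?_
  simp only [Param.mixture, Measure.smul_apply, Measure.add_apply, smul_eq_mul, mul_eq_zero,
    ENNReal.inv_eq_zero, ENNReal.ofNat_ne_top, false_or, add_eq_zero] at hs
  match x with
  | 0 => exact hs.1
  | 1 => exact hs.2

/-- A finite density of the emission distribution of `x` with respect to the mixture. -/
def Param.density (θ : Param 2 𝕐 L) (x : Fin 2) (y : 𝕐) : ℝ :=
  ((θ.emission x).rnDeriv θ.mixture y).toReal

theorem Param.density_nonneg (θ : Param 2 𝕐 L) (x : Fin 2) (y : 𝕐) : 0 ≤ θ.density x y :=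
  ENNReal.toReal_nonneg

theorem Param.measurable_density (θ : Param 2 𝕐 L) (x : Fin 2) : Measurable (θ.density x) :=
  (Measure.measurable_rnDeriv _ _).ennreal_toReal

theorem Param.withDensity_density (θ : Param 2 𝕐 L) (x : Fin 2) :
    θ.mixture.withDensity (fun y => ENNReal.ofReal (θ.density x y)) = θ.emission x := by
  rw [← Measure.withDensity_rnDeriv_eq _ _ (θ.emission_absolutelyContinuous x)]
  refine withDensity_congr_ae ?_
  filter_upwards [Measure.rnDeriv_lt_top (θ.emission x) θ.mixture] with y hy
  exact ENNReal.ofReal_toReal hy.ne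

/-- The joint density of the hidden states and the observations. -/
def Param.weight (θ : Param 2 𝕐 L) {n : ℕ} (y : Fin n → 𝕐) (v : Fin n → Fin 2) : ℝ :=
  θ.pathProb v * ∏ i, θ.density (v i) (y i)

theorem Param.pathProb_nonneg {J : ℕ} (θ : Param J 𝕐 L) {n : ℕ} (v : Fin n → Fin J) :
    0 ≤ θ.pathProb v := by
  cases n with
  | zero => exact zero_le_one
  | succ n => exact mul_nonneg (θ.ν_nonneg _) (Finset.prod_nonneg fun i _ => θ.Q_nonneg _ _)

theorem Param.weight_nonneg (θ : Param 2 𝕐 L) {n : ℕ} (y : Fin n → 𝕐) (v : Fin n → Fin 2) :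
    0 ≤ θ.weight y v :=
  mul_nonneg (θ.pathProb_nonneg v) (Finset.prod_nonneg fun _ _ => θ.density_nonneg _ _)

theorem Param.measurable_weight (θ : Param 2 𝕐 L) {n : ℕ} (v : Fin n → Fin 2) :
    Measurable fun y : Fin n → 𝕐 => θ.weight y v :=
  (Finset.measurable_fun_prod _ fun i _ =>
    (θ.measurable_density (v i)).comp (measurable_pi_apply i)).const_mul _

theorem Param.pi_emission (θ : Param 2 𝕐 L) {n : ℕ} (v : Fin n → Fin 2) :
    Measure.pi (fun i => θ.emission (v i)) = (Measure.pi fun _ : Fin n => θ.mixture).withDensity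
      fun y => ENNReal.ofReal (∏ i, θ.density (v i) (y i)) := by
  have e : (fun i => θ.emission (v i)) = fun i =>
      θ.mixture.withDensity fun y => ENNReal.ofReal (θ.density (v i) y) :=
    funext fun i => (θ.withDensity_density (v i)).symm
  have : ∀ i, SigmaFinite (θ.mixture.withDensity
      ((fun i y => ENNReal.ofReal (θ.density (v i) y)) i)) := fun i => by
    simp only [θ.withDensity_density]; infer_instance
  rw [e, pi_withDensity θ.mixture (fun i y => ENNReal.ofReal (θ.density (v i) y))
    fun i => (θ.measurable_density _).ennreal_ofReal]
  simp only [ENNReal.ofReal_prod_of_nonneg fun i _ => θ.density_nonneg _ _]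

theorem Param.integrable_weight_mul (θ : Param 2 𝕐 L) {n : ℕ} (v : Fin n → Fin 2)
    {F : (Fin n → 𝕐) → ℝ} (hF : Measurable F) {C : ℝ} (hC : ∀ y, |F y| ≤ C) :
    Integrable (fun y => θ.weight y v * F y) (Measure.pi fun _ => θ.mixture) ∧
      ∫ y, θ.weight y v * F y ∂(Measure.pi fun _ => θ.mixture) =
        θ.pathProb v * ∫ y, F y ∂(Measure.pi fun i => θ.emission (v i)) := by
  have hm : Measurable fun y : Fin n → 𝕐 => ENNReal.ofReal (∏ i, θ.density (v i) (y i)) :=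
    (Finset.measurable_fun_prod _ fun i _ =>
      (θ.measurable_density (v i)).comp (measurable_pi_apply i)).ennreal_ofReal
  have hlt : ∀ᵐ y ∂(Measure.pi fun _ : Fin n => θ.mixture),
      ENNReal.ofReal (∏ i, θ.density (v i) (y i)) < ⊤ :=
    Filter.Eventually.of_forall fun _ => ENNReal.ofReal_lt_top
  have htr : ∀ y : Fin n → 𝕐, (ENNReal.ofReal (∏ i, θ.density (v i) (y i))).toReal =
      ∏ i, θ.density (v i) (y i) := fun y =>
    ENNReal.toReal_ofReal (Finset.prod_nonneg fun _ _ => θ.density_nonneg _ _)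
  have hint : Integrable F (Measure.pi fun i => θ.emission (v i)) :=
    Integrable.of_bound hF.aestronglyMeasurable C (Filter.Eventually.of_forall hC)
  rw [θ.pi_emission] at hint ⊢
  rw [integrable_withDensity_iff_integrable_smul' hm hlt] at hint
  rw [integral_withDensity_eq_integral_toReal_smul hm hlt]
  simp only [htr, smul_eq_mul] at hint ⊢
  simp only [Param.weight, mul_assoc]
  exact ⟨hint.const_mul _, integral_const_mul _ _⟩

/-- Both risks become integrals over `y` against one common product measure, so they can be compared
pointwise through the unnormalized posterior `weight`. -/
theorem Param.integral_law (θ : Param 2 𝕐 L) {n : ℕ} {F : (Fin n → Fin 2) → (Fin n → 𝕐) → ℝ}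
    (hF : ∀ v, Measurable (F v)) {C : ℝ} (hC : ∀ v y, |F v y| ≤ C) :
    Integrable (fun y => ∑ v, θ.weight y v * F v y) (Measure.pi fun _ => θ.mixture) ∧
      ∫ p, F p.1 p.2 ∂(θ.law n) =
        ∫ y, ∑ v, θ.weight y v * F v y ∂(Measure.pi fun _ => θ.mixture) := by
  have hm : Measurable fun p : (Fin n → Fin 2) × (Fin n → 𝕐) => F p.1 p.2 :=
    measurable_from_prod_countable_right hF
  refine ⟨integrable_finsetSum _ fun v _ => (θ.integrable_weight_mul v (hF v) (hC v)).1, ?_⟩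
  rw [integral_finsetSum _ fun v _ => (θ.integrable_weight_mul v (hF v) (hC v)).1, Param.law,
    integral_finsetSum_measure]
  · refine Finset.sum_congr rfl fun v _ => ?_
    rw [(θ.integrable_weight_mul v (hF v) (hC v)).2, integral_smul_measure, Measure.dirac_prod,
      integral_map measurable_prodMk_left.aemeasurable hm.aestronglyMeasurable,
      ENNReal.toReal_ofReal (θ.pathProb_nonneg v), smul_eq_mul]
  · intro v _
    exact (Integrable.of_bound hm.aestronglyMeasurable C
      (Filter.Eventually.of_forall fun p => hC p.1 p.2)).smul_measure ENNReal.ofReal_ne_top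

theorem measurable_loss_comp {n : ℕ} {g : (Fin n → 𝕐) → Partition n} (hg : Measurable g)
    (v : Fin n → Fin 2) : Measurable fun y => loss (g y) (labelPartition v) :=
  (measurable_from_top (f := fun A => loss A (labelPartition v))).comp hg

theorem measurable_mismatches_comp {n : ℕ} {h : (Fin n → 𝕐) → Fin n → Fin 2} (hh : Measurable h)
    (v : Fin n → Fin 2) : Measurable fun y => (1 / (n : ℝ)) * mismatches (h y) v :=
  (Measurable.of_discrete (f := fun u => (1 / (n : ℝ)) * mismatches u v)).comp hh

theorem abs_mismatches_div_le {n : ℕ} (hn : 1 ≤ n) (h v : Fin n → Fin 2) :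
    |(1 / (n : ℝ)) * mismatches h v| ≤ 1 := by
  have hn0 : (0 : ℝ) < n := by positivity
  rw [abs_of_nonneg (mul_nonneg (by positivity) (mismatches_nonneg h v)), one_div,
    inv_mul_le_iff₀ hn0, mul_one]
  exact mismatches_le h v

theorem abs_loss_le {n : ℕ} (hn : 1 ≤ n) (A : Partition n) (v : Fin n → Fin 2) :
    |loss A (labelPartition v)| ≤ 1 := by
  rw [abs_of_nonneg (loss_nonneg hn A v), loss]
  have : 0 ≤ 1 / (n : ℝ) * maxOverlap A (labelPartition v) := by positivity
  linarith

theorem Param.classRisk_eq (θ : Param 2 𝕐 L) {n : ℕ} (hn : 1 ≤ n) (h : Classifier 2 𝕐 n) :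
    Integrable (fun y => ∑ v, θ.weight y v * ((1 / (n : ℝ)) * mismatches (h.1 y) v))
        (Measure.pi fun _ => θ.mixture) ∧
      θ.classRisk h = ∫ y, ∑ v, θ.weight y v * ((1 / (n : ℝ)) * mismatches (h.1 y) v)
        ∂(Measure.pi fun _ => θ.mixture) :=
  θ.integral_law (F := fun v y => (1 / (n : ℝ)) * mismatches (h.1 y) v)
    (measurable_mismatches_comp h.2) fun v y => abs_mismatches_div_le hn (h.1 y) v

theorem Param.clustRisk_eq (θ : Param 2 𝕐 L) {n : ℕ} (hn : 1 ≤ n) (g : Clusterer 𝕐 n) :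
    Integrable (fun y => ∑ v, θ.weight y v * loss (g.1 y) (labelPartition v))
        (Measure.pi fun _ => θ.mixture) ∧
      θ.clustRisk g = ∫ y, ∑ v, θ.weight y v * loss (g.1 y) (labelPartition v)
        ∂(Measure.pi fun _ => θ.mixture) :=
  θ.integral_law (F := fun v y => loss (g.1 y) (labelPartition v))
    (measurable_loss_comp g.2) fun v y => abs_loss_le hn (g.1 y) v

theorem Param.classRisk_nonneg (θ : Param 2 𝕐 L) {n : ℕ} (h : Classifier 2 𝕐 n) :
    0 ≤ θ.classRisk h :=
  integral_nonneg fun p => mul_nonneg (by positivity) (mismatches_nonneg (h.1 p.2) p.1)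

theorem Param.clustRisk_nonneg (θ : Param 2 𝕐 L) {n : ℕ} (hn : 1 ≤ n) (g : Clusterer 𝕐 n) :
    0 ≤ θ.clustRisk g :=
  integral_nonneg fun p => loss_nonneg hn (g.1 p.2) p.1

/-! ### The marginal classifier and the pointwise comparison -/

/-- The classifier which maximizes the posterior marginals. -/
def Param.marginalClassifier (θ : Param 2 𝕐 L) (n : ℕ) : Classifier 2 𝕐 n :=
  ⟨fun y i => if ∑ v with v i = 1, θ.weight y v ≤ ∑ v with v i = 0, θ.weight y v then 0 else 1,
    measurable_pi_lambda _ fun _ => Measurable.ite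
      (measurableSet_le (Finset.measurable_fun_sum _ fun v _ => θ.measurable_weight v)
        (Finset.measurable_fun_sum _ fun v _ => θ.measurable_weight v))
      measurable_const measurable_const⟩

/-- The expected number of mismatches is a sum over coordinates, so it is minimized one coordinate
at a time. -/
theorem Param.sum_weight_marginalClassifier_le (θ : Param 2 𝕐 L) {n : ℕ} (y : Fin n → 𝕐)
    (h : Fin n → Fin 2) :
    ∑ v, θ.weight y v * mismatches ((θ.marginalClassifier n).1 y) v ≤
      ∑ v, θ.weight y v * mismatches h v := by
  have hswap : ∀ u : Fin n → Fin 2, ∑ v, θ.weight y v * mismatches u v =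
      ∑ i, ∑ v with u i ≠ v i, θ.weight y v := fun u => by
    simp only [mismatches, Finset.mul_sum, Finset.sum_filter]
    rw [Finset.sum_comm]
    exact Finset.sum_congr rfl fun i _ => Finset.sum_congr rfl fun v _ => by split_ifs <;> simp
  rw [hswap, hswap]
  refine Finset.sum_le_sum fun i _ => ?_
  have h0 : ∀ v : Fin n → Fin 2, (0 : Fin 2) ≠ v i ↔ v i = 1 := fun v => by
    generalize v i = a; revert a; decide
  have h1 : ∀ v : Fin n → Fin 2, (1 : Fin 2) ≠ v i ↔ v i = 0 := fun v => by
    generalize v i = a; revert a; decide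
  simp only [Param.marginalClassifier]
  rcases Fin.exists_fin_two.1 ⟨h i, rfl⟩ with e | e <;> rw [e] <;> split_ifs with hc <;>
    simp only [h0, h1] <;> first | exact le_rfl | exact hc | exact (not_le.1 hc).le

/-- The initial law enters as a first transition that ignores its source, so the starting state `0`
is arbitrary; the value `1` beyond index `n` is never read. -/
theorem Param.sum_weight_mul_eq_chainSum (θ : Param 2 𝕐 L) {n : ℕ} (hn : 1 ≤ n)
    (y : Fin n → 𝕐) (F : (Fin n → Fin 2) → ℝ) :
    ∑ v, θ.weight y v * F v = chainSum n (fun i x z =>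
      (if i = 0 then θ.ν z else θ.Q x z) *
        (if hi : i < n then θ.density z (y ⟨i, hi⟩) else 1)) 0 F := by
  obtain ⟨n, rfl⟩ : ∃ m, n = m + 1 := ⟨n - 1, by omega⟩
  rw [chainSum_eq_sum]
  refine Finset.sum_congr rfl fun v _ => ?_
  congr 1
  rw [Finset.prod_mul_distrib, Param.weight, Param.pathProb]
  congr 1
  · rw [Fin.prod_univ_succ]
    simp [Fin.castSucc_succ]
  · exact Finset.prod_congr rfl fun i _ => by rw [dif_pos i.2]

theorem Param.IsMixing.bounds {θ : Param 2 𝕐 L} {δ : ℝ} (hmix : θ.IsMixing δ) :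
    0 < δ ∧ δ ≤ 1 / 2 ∧ (∀ x z, δ ≤ θ.Q x z) ∧ (∀ x z, θ.Q x z ≤ 1 - δ) ∧
      (∀ x, δ ≤ θ.ν x) ∧ ∀ x, θ.ν x ≤ 1 - δ := by
  obtain ⟨⟨-, hle⟩, hδ, hν⟩ := hmix
  have hQ : ∀ x z, δ ≤ θ.Q x z := fun x z => hle ⟨(x, z), rfl⟩
  have hQs := θ.Q_sum
  have hνs := θ.ν_sum
  simp only [Fin.sum_univ_two] at hQs hνs
  refine ⟨hδ, by linarith [hQ 0 0, hQ 0 1, hQs 0], hQ, fun x z => ?_, hν, fun x => ?_⟩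
  · match z with
    | 0 => linarith [hQ x 1, hQs x]
    | 1 => linarith [hQ x 0, hQs x]
  · match x with
    | 0 => linarith [hν 1]
    | 1 => linarith [hν 0]

theorem Param.le_sum_weight_mul_loss (θ : Param 2 𝕐 L) {δ : ℝ} (hmix : θ.IsMixing δ) {n : ℕ}
    (hn : 2 ≤ n) (hα : alphaTilde δ n ≤ 1) (y : Fin n → 𝕐) (A : Partition n) :
    (1 - alphaTilde δ n) *
        ∑ v, θ.weight y v * ((1 / (n : ℝ)) * mismatches ((θ.marginalClassifier n).1 y) v) ≤
      ∑ v, θ.weight y v * loss A (labelPartition v) := by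
  obtain ⟨hδ, hδ2, hQ, hQ', hν, hν'⟩ := hmix.bounds
  obtain ⟨K, hK, hKF⟩ := exists_isMixingKernel hδ n (fun i x z => if i = 0 then θ.ν z else θ.Q x z)
    (fun i x z => by split_ifs; exacts [hν z, hQ x z])
    (fun i x z => by split_ifs; exacts [hν' z, hQ' x z]) hδ2
    (fun i z => if hi : i < n then θ.density z (y ⟨i, hi⟩) else 1)
    (fun i z => by split_ifs; exacts [θ.density_nonneg _ _, zero_le_one])
  have hW : ∀ F, ∑ v, θ.weight y v * F v = (∑ v, θ.weight y v) * chainSum n K 0 F := fun F => by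
    have h1 := θ.sum_weight_mul_eq_chainSum (by omega) y (fun _ => 1)
    simp only [mul_one] at h1
    rw [θ.sum_weight_mul_eq_chainSum (by omega), hKF, h1]
  -- Observations of zero total weight contribute nothing; otherwise the weight can be cancelled to
  -- pass to the posterior chain.
  rcases (Finset.sum_nonneg fun v (_ : v ∈ Finset.univ) => θ.weight_nonneg y v).eq_or_lt
    with h0 | hpos
  · rw [hW, hW, ← h0]; simp
  have hmin : ∀ h', chainSum n K 0 (mismatches ((θ.marginalClassifier n).1 y)) ≤
      chainSum n K 0 (mismatches h') := fun h' => by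
    have := θ.sum_weight_marginalClassifier_le y h'
    rw [hW, hW] at this
    exact le_of_mul_le_mul_left this hpos
  have := mul_le_mul_of_nonneg_left (hK.le_expected_loss hδ hδ2 hn hα 0 A hmin) hpos.le
  rw [hW, hW, chainSum_mul_left]
  linarith

/-! ### Small samples and conclusion -/

/-- For `n ≤ 2` the exponent `1 - 2 / n` is `-1` or `0` and the lower bound is vacuous. -/
theorem one_le_alphaTilde {δ : ℝ} (hδ : 0 < δ) (hδ2 : δ ≤ 1 / 2) {n : ℕ} (hn : 1 ≤ n)
    (hn2 : n ≤ 2) : 1 ≤ alphaTilde δ n := by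
  have hr : 1 ≤ (1 - δ) / δ := by rw [le_div_iff₀ hδ]; linarith
  have he : (2 : ℝ) ≤ Real.exp 1 := by linarith [Real.add_one_le_exp (1 : ℝ)]
  unfold alphaTilde
  set r := (1 - δ) / δ
  have hr4 : 1 ≤ r ^ 4 := one_le_pow₀ hr
  interval_cases n
  · have hs : Real.sqrt (Real.log 2 / (2 * ((1 : ℕ) : ℝ))) ≤ 1 := by
      rw [Real.sqrt_le_one]
      push_cast
      linarith [Real.log_two_lt_d9]
    have hs0 : 0 < Real.sqrt (Real.log 2 / (2 * ((1 : ℕ) : ℝ))) :=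
      Real.sqrt_pos.2 (by have := Real.log_pos one_lt_two; positivity)
    rw [show (1 : ℝ) - 2 / ((1 : ℕ) : ℝ) = -1 by norm_num, Real.rpow_neg_one]
    rw [← div_eq_mul_inv, one_le_div (by positivity)]
    have h1 : r * Real.sqrt (Real.log 2 / (2 * ((1 : ℕ) : ℝ))) ≤ r := by nlinarith
    have h2 : r ≤ r ^ 4 := le_self_pow₀ hr (by norm_num)
    nlinarith
  · rw [show (1 : ℝ) - 2 / ((2 : ℕ) : ℝ) = 0 by norm_num, Real.rpow_zero]
    nlinarith

theorem Param.clustRisk_labelPartition_le (θ : Param 2 𝕐 L) {n : ℕ} (hn : 1 ≤ n)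
    (h : Classifier 2 𝕐 n) :
    θ.clustRisk ⟨fun y => labelPartition (h.1 y), (Measurable.of_discrete (f := labelPartition)).comp h.2⟩ ≤
      θ.classRisk h := by
  obtain ⟨i1, e1⟩ := θ.clustRisk_eq hn
    ⟨fun y => labelPartition (h.1 y), (Measurable.of_discrete (f := labelPartition)).comp h.2⟩
  obtain ⟨i2, e2⟩ := θ.classRisk_eq hn h
  rw [e1, e2]
  exact integral_mono i1 i2 fun y => Finset.sum_le_sum fun v _ =>
    mul_le_mul_of_nonneg_left (loss_labelPartition_le hn (h.1 y) v) (θ.weight_nonneg y v)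

end HMMClustering
end

theorem theorem9 {𝕐 : Type*} [TopologicalSpace 𝕐] [PolishSpace 𝕐] [MeasurableSpace 𝕐]
    [BorelSpace 𝕐] (L : Measure 𝕐) (θ : HMMClustering.Param 2 𝕐 L) (hdep : θ.IsDependent)
    (δ : ℝ) (hmix : θ.IsMixing δ) (n : ℕ) (hn : 1 ≤ n) :
    (1 - HMMClustering.alphaTilde δ n) * θ.bayesClassRisk n ≤ θ.bayesClustRisk n ∧
      θ.bayesClustRisk n ≤ θ.bayesClassRisk n := by
  have : Nonempty (HMMClustering.Clusterer 𝕐 n) :=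
    ⟨⟨fun _ => HMMClustering.labelPartition (fun _ => (0 : Fin 2)), measurable_const⟩⟩
  have : Nonempty (HMMClustering.Classifier 2 𝕐 n) := ⟨⟨fun _ _ => 0, measurable_const⟩⟩
  have hclass : BddBelow (Set.range fun h : HMMClustering.Classifier 2 𝕐 n => θ.classRisk h) :=
    ⟨0, by rintro _ ⟨h, rfl⟩; exact θ.classRisk_nonneg h⟩
  have hclust : BddBelow (Set.range fun g : HMMClustering.Clusterer 𝕐 n => θ.clustRisk g) :=
    ⟨0, by rintro _ ⟨g, rfl⟩; exact θ.clustRisk_nonneg hn g⟩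
  refine ⟨le_ciInf fun g => ?_, le_ciInf fun h =>
    (ciInf_le hclust _).trans (θ.clustRisk_labelPartition_le hn h)⟩
  have hclass0 : 0 ≤ θ.bayesClassRisk n := le_ciInf fun h => θ.classRisk_nonneg h
  obtain ⟨hδ, hδ2, -⟩ := hmix.bounds
  rcases le_total 1 (HMMClustering.alphaTilde δ n) with hα | hα
  · exact (mul_nonpos_of_nonpos_of_nonneg (by linarith) hclass0).trans (θ.clustRisk_nonneg hn g)
  rcases lt_or_ge n 3 with hn3 | hn3
  · have := HMMClustering.one_le_alphaTilde hδ hδ2 hn (by omega)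
    exact (mul_nonpos_of_nonpos_of_nonneg (by linarith) hclass0).trans (θ.clustRisk_nonneg hn g)
  obtain ⟨i1, e1⟩ := θ.classRisk_eq hn (θ.marginalClassifier n)
  obtain ⟨i2, e2⟩ := θ.clustRisk_eq hn g
  refine (mul_le_mul_of_nonneg_left (ciInf_le hclass (θ.marginalClassifier n))
    (by linarith)).trans ?_
  rw [e1, e2, ← integral_const_mul]
  exact integral_mono (i1.const_mul _) i2 fun y =>
    θ.le_sum_weight_mul_loss hmix (by omega) hα y (g.1 y)
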